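/- **Setting.** Let $H$ be a commutative Hopf algebra over $\mathbb C$ which, as an algebra, is a polynomial algebra on a set $D$ of "connected (1PI) diagrams"; for instance $H=H_{\rm FG}(\Phi)$, the renormalization Hopf algebra of Feynman diagrams of an interacting quantum field theory $\Phi$. A *Dyson--Schwinger equation* (DSE) is $$X=1+\sum_{n\ge 1} g^n\omega_n B_n(X^{n+1}),\qquad \omega_n\in\mathbb C,$$ where each $B_n:H\to H$ is a Hochschild one-cocycle, $\Delta B_n=B_n\otimes 1+({\rm id}\otimes B_n)\Delta$ (insertion into the primitive element $\gamma_n=B_n(1)$), whose values are linear combinations of connected diagrams, and $\omega_1\ne 0$, $\gamma_1\neq0$. Its unique solution is $X=\sum_{n\ge0} g^nX_n$ with $X_0=1$ and $X_n=\sum_{j=1}^n\omega_jB_j\big(\sum_{k_1+\dots+k_{j+1}=n-j}X_{k_1}\cdots X_{k_{j+1}}\big)$. For $N\in\{1,2,\dots,\infty\}$ let $H(X_1,\dots,X_N)\subseteq H$ be the subalgebra generated by the $X_m$, $m\le N$; for $N=\infty$ it is $H_{\rm DSE}$. Interactions of a particle $p$ are given by such an equation ${\rm DSE}_p$, with operators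 $B_n$. The *tower* over $p$ consists of the equations ${\rm DSE}_p^{(j)}$, $j\ge0$, with the same weights and operators $B^{(0)}_n=B_n$, $B^{(j)}_n=B^{(j-1)}_1+\dots+B^{(j-1)}_n$ (insertion into $\Gamma^{(j)}_n=\Gamma^{(j-1)}_1+\dots+\Gamma^{(j-1)}_n$, $\Gamma^{(0)}_n=\gamma_n$). **Theorem.** (1) For every DSE and every $N$, $A=H(X_1,\dots,X_N)$ is a Hopf subalgebra of $H$, and there is an action of $\mathbb G_m(\mathbb C)=\mathbb C^\times$ by automorphisms on the complex Lie group $G={\rm Hom}_{\rm alg}(A,\mathbb C)$ of characters (with convolution product) for which $(z\cdot\phi)(X_m)=z^m\phi(X_m)$. Let $G^*=G\rtimes\mathbb G_m$. The category ${\rm Rep}_{G^*}$ of finite dimensional rational representations of $G^*$ (those whose matrix coefficients lie in the span of the functions $(\phi,z)\mapsto\phi(a)z^n$, $a\in A$, $n\in\mathbb Z$) is a neutral Tannakian category over $\mathbb C$, with the forgetful functor as fibre functor. (2) Let $A=H(X_1,\dots,X_N)$ and $A'=H(X'_1,\dots,X'_{N'})$ be two such Hopf algebras and let $i:A\to A'$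 be a *natural* injective Hopf algebra homomorphism, i.e. $i(X_m)=X'_m$ for all $m\le N$. Then $\tilde i:G_{A'}\to G_A$, $\phi\mapsto\phi\circ i$, and $G_{A'}^*\to G_A^*$, $(\phi,z)\mapsto(\phi\circ i,z)$, are surjective group homomorphisms, and pulling back representations is an exact fully faithful symmetric tensor functor ${\rm Rep}_{G_A^*}\to{\rm Rep}_{G_{A'}^*}$ whose essential image is closed under subobjects and quotients. In (3) and (4), an *arrow* ${\rm Rep}_{G_A^*}\to{\rm Rep}_{G_{A'}^*}$ means such a functor obtained from such an $i$. Any family of these categories is ordered by: ${\rm Rep}_{K^*}\preceq{\rm Rep}_{G^*}$ if and only if there is a finite sequence of arrows ${\rm Rep}_{K^*}\to\cdots\to{\rm Rep}_{G^*}$ through members of the family. (3) (One particle.) For a particle $p$ let ${\rm Cat}_p$ be the family of the categories ${\rm Rep}_{G^*}$ for the Hopf algebras $H(X^{(j)}_1,\dots,X^{(j)}_N)$, $j\ge0$, $1\le N\le\infty$, where $X^{(j)}$ solves ${\rm DSE}_p^{(j)}$. There is an arrow from the member $(j,N)$ to the member $(j',N')$ whenever $j\le j'$ and $N\le N'$.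 After identifying members that precede each other, $({\rm Cat}_p,\preceq)$ is a lattice; members which are so identified are equivalent through an arrow. The member $(0,1)$ is a least element. (4) (Two particles.) Let $p,q$ be particles, let $j_1,j_2,k\ge0$, and let ${\rm DSE}_{p^\epsilon}$, ${\rm DSE}_c$, ${\rm DSE}_{q^\epsilon}$ be any intermediate DSEs. Write ${\rm Rep}_{G^*_{p^{(j)}}}$ etc. for the categories attached to the full Hopf algebras ($N=\infty$). There are arrows ${\rm Rep}_{G^*_{p^{(j)}}}\to{\rm Rep}_{G^*_{p^{(j+1)}}}$ for $j<j_1$ and ${\rm Rep}_{G^*_{q^{(j)}}}\to{\rm Rep}_{G^*_{q^{(j+1)}}}$ for $j<j_2$, and the two chains are connected by arrows $${\rm Rep}_{G^*_{p^{(j_1)}}}\to{\rm Rep}_{G^*_{p^{\epsilon}}}\to{\rm Rep}_{G^*_{c^{(k)}}}\to{\rm Rep}_{G^*_{q^{\epsilon}}}\to{\rm Rep}_{G^*_{q^{(j_2)}}}$$ and by arrows in the opposite direction. The family which consists of the members $(j,N)$, $j\le j_1$, of ${\rm Cat}_p$, the members $(j,N)$, $j\le j_2$, of ${\rm Cat}_q$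 and the three intermediate categories is, after the same identification, a lattice for $\preceq$; members which are identified are equivalent through an arrow. -/

import Mathlib

namespace QFTEntanglement

noncomputable section

open CategoryTheory CategoryTheory.Limits
open scoped TensorProduct

universe u v

section HopfSubalgebra

/-- A Hopf subalgebra of a commutative Hopf algebra over a field: a subalgebra `A` with
`Δ(A) ⊆ A ⊗ A` and `S(A) ⊆ A`. -/
structure HopfSubalgebra (k : Type u) (H : Type v) [Field k] [CommRing H] [HopfAlgebra k H]
    extends Subalgebra k H where
  comul_mem : ∀ a ∈ toSubalgebra, Bialgebra.comulAlgHom k H a ∈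
    (Algebra.TensorProduct.map toSubalgebra.val toSubalgebra.val).range
  antipode_mem : ∀ a ∈ toSubalgebra, HopfAlgebra.antipode k a ∈ toSubalgebra

namespace HopfSubalgebra

variable {k : Type u} {H : Type v} [Field k] [CommRing H] [HopfAlgebra k H]

theorem map_val_injective (A : Subalgebra k H) :
    Function.Injective (Algebra.TensorProduct.map A.val A.val) := by
  have h : Function.Injective (TensorProduct.map A.val.toLinearMap A.val.toLinearMap) :=
    TensorProduct.map_injective_of_flat_flat _ _ Subtype.val_injective Subtype.val_injective
  exact h

theorem map_map_val_injective (A : Subalgebra k H) :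
    Function.Injective (Algebra.TensorProduct.map A.val
      (Algebra.TensorProduct.map A.val A.val)) := by
  have h : Function.Injective (TensorProduct.map A.val.toLinearMap
      (Algebra.TensorProduct.map A.val A.val).toLinearMap) :=
    TensorProduct.map_injective_of_flat_flat _ _ Subtype.val_injective (map_val_injective A)
  exact h

variable (A : HopfSubalgebra k H)

/-- The coproduct of `H`, corestricted to a map `A → A ⊗ A`. -/
def comulHom : A.toSubalgebra →ₐ[k] A.toSubalgebra ⊗[k] A.toSubalgebra :=
  (AlgEquiv.ofInjective _ (map_val_injective A.toSubalgebra)).symm.toAlgHom.comp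
    (((Bialgebra.comulAlgHom k H).comp A.toSubalgebra.val).codRestrict _
      (fun a => A.comul_mem a.1 a.2))

theorem map_comulHom (a : A.toSubalgebra) :
    Algebra.TensorProduct.map A.toSubalgebra.val A.toSubalgebra.val (A.comulHom a) =
      Coalgebra.comul (R := k) (a : H) := by
  have h := AlgEquiv.apply_symm_apply
    (AlgEquiv.ofInjective _ (map_val_injective A.toSubalgebra))
    ((((Bialgebra.comulAlgHom k H).comp A.toSubalgebra.val).codRestrict _
      (fun a => A.comul_mem a.1 a.2)) a)
  exact congrArg Subtype.val h

theorem map_comp_comulHom :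
    (Algebra.TensorProduct.map A.toSubalgebra.val A.toSubalgebra.val).comp A.comulHom =
      (Bialgebra.comulAlgHom k H).comp A.toSubalgebra.val :=
  AlgHom.ext A.map_comulHom

/-- The antipode of `H`, corestricted to `A`. -/
def antipodeMap : A.toSubalgebra →ₗ[k] A.toSubalgebra :=
  (HopfAlgebra.antipode k (A := H)).restrict (p := Subalgebra.toSubmodule A.toSubalgebra)
    (q := Subalgebra.toSubmodule A.toSubalgebra) A.antipode_mem

theorem coe_antipodeMap (a : A.toSubalgebra) :
    (A.antipodeMap a : H) = HopfAlgebra.antipode k (a : H) := rfl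

theorem coassoc_aux :
    (Algebra.TensorProduct.assoc k k k A.toSubalgebra A.toSubalgebra A.toSubalgebra).toAlgHom.comp
      ((Algebra.TensorProduct.map A.comulHom (.id k A.toSubalgebra)).comp A.comulHom) =
    (Algebra.TensorProduct.map (.id k A.toSubalgebra) A.comulHom).comp A.comulHom := by
  set ι := A.toSubalgebra.val with hι
  set ι₂ := Algebra.TensorProduct.map ι ι with hι₂
  have hδ : ι₂.comp A.comulHom = (Bialgebra.comulAlgHom k H).comp ι := A.map_comp_comulHom
  have e1 : ((Algebra.TensorProduct.map ι ι₂).comp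
      (Algebra.TensorProduct.assoc k k k A.toSubalgebra A.toSubalgebra
        A.toSubalgebra).toAlgHom).comp (Algebra.TensorProduct.map A.comulHom (.id k _)) =
      ((Algebra.TensorProduct.assoc k k k H H H).toAlgHom.comp
        (Algebra.TensorProduct.map (Bialgebra.comulAlgHom k H) (.id k H))).comp ι₂ := by
    have h0 : (Algebra.TensorProduct.map ι ι₂).comp
      (Algebra.TensorProduct.assoc k k k A.toSubalgebra A.toSubalgebra
        A.toSubalgebra).toAlgHom = (Algebra.TensorProduct.assoc k k k H H H).toAlgHom.comp
          (Algebra.TensorProduct.map ι₂ ι) := by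
      ext <;> simp [hι₂, Algebra.TensorProduct.one_def]
    rw [h0, AlgHom.comp_assoc, AlgHom.comp_assoc, ← Algebra.TensorProduct.map_comp, hδ,
      hι₂, ← Algebra.TensorProduct.map_comp]
    rfl
  have e2 : (Algebra.TensorProduct.map ι ι₂).comp
      (Algebra.TensorProduct.map (.id k _) A.comulHom) =
      (Algebra.TensorProduct.map (.id k H) (Bialgebra.comulAlgHom k H)).comp ι₂ := by
    rw [← Algebra.TensorProduct.map_comp, hδ, hι₂, ← Algebra.TensorProduct.map_comp]
    rfl
  have hH : ((Algebra.TensorProduct.assoc k k k H H H).toAlgHom.comp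
        (Algebra.TensorProduct.map (Bialgebra.comulAlgHom k H) (.id k H))).comp
          (Bialgebra.comulAlgHom k H) =
      (Algebra.TensorProduct.map (.id k H) (Bialgebra.comulAlgHom k H)).comp
        (Bialgebra.comulAlgHom k H) :=
    AlgHom.ext fun x => Coalgebra.coassoc_apply (R := k) x
  refine AlgHom.ext fun a => map_map_val_injective A.toSubalgebra ?_
  have c1 := congrArg (fun f => f (A.comulHom a)) e1
  have c2 := congrArg (fun f => f (A.comulHom a)) e2
  have c3 := congrArg (fun f => f (ι a)) hH
  have c4 := congrArg (fun f => f a) hδ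
  simp only [AlgHom.comp_apply] at c1 c2 c3 c4 ⊢
  exact c1.trans ((congrArg _ (congrArg _ c4)).trans (c3.trans
    ((congrArg _ c4).symm.trans c2.symm)))

theorem rTensor_aux :
    (Algebra.TensorProduct.map ((Bialgebra.counitAlgHom k H).comp A.toSubalgebra.val)
      (.id k A.toSubalgebra)).comp A.comulHom =
        (Algebra.TensorProduct.lid k A.toSubalgebra).symm.toAlgHom := by
  refine AlgHom.ext fun a => (Algebra.TensorProduct.lid k A.toSubalgebra).injective ?_
  refine Subtype.val_injective ?_
  have e : ((A.toSubalgebra.val).comp (Algebra.TensorProduct.lid k A.toSubalgebra).toAlgHom).comp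
      (Algebra.TensorProduct.map ((Bialgebra.counitAlgHom k H).comp A.toSubalgebra.val)
        (.id k A.toSubalgebra)) =
      ((Algebra.TensorProduct.lid k H).toAlgHom.comp
        (Algebra.TensorProduct.map (Bialgebra.counitAlgHom k H) (.id k H))).comp
          (Algebra.TensorProduct.map A.toSubalgebra.val A.toSubalgebra.val) := by
    ext <;> simp
  have c := congrArg (fun f => f (A.comulHom a)) e
  simp only [AlgHom.comp_apply, A.map_comulHom] at c
  refine Eq.trans c ?_
  have h := Coalgebra.rTensor_counit_comul (R := k) (a : H)
  have h' : Algebra.TensorProduct.map (Bialgebra.counitAlgHom k H) (.id k H)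
      (Coalgebra.comul (R := k) (a : H)) = (1 : k) ⊗ₜ[k] (a : H) := h
  rw [h']
  simp

theorem lTensor_aux :
    (Algebra.TensorProduct.map (.id k A.toSubalgebra)
      ((Bialgebra.counitAlgHom k H).comp A.toSubalgebra.val)).comp A.comulHom =
        (Algebra.TensorProduct.rid k k A.toSubalgebra).symm.toAlgHom := by
  refine AlgHom.ext fun a => (Algebra.TensorProduct.rid k k A.toSubalgebra).injective ?_
  refine Subtype.val_injective ?_
  have e : ((A.toSubalgebra.val).comp
        (Algebra.TensorProduct.rid k k A.toSubalgebra).toAlgHom).comp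
      (Algebra.TensorProduct.map (.id k A.toSubalgebra)
        ((Bialgebra.counitAlgHom k H).comp A.toSubalgebra.val)) =
      ((Algebra.TensorProduct.rid k k H).toAlgHom.comp
        (Algebra.TensorProduct.map (.id k H) (Bialgebra.counitAlgHom k H))).comp
          (Algebra.TensorProduct.map A.toSubalgebra.val A.toSubalgebra.val) := by
    ext <;> simp
  have c := congrArg (fun f => f (A.comulHom a)) e
  simp only [AlgHom.comp_apply, A.map_comulHom] at c
  refine Eq.trans c ?_
  have h := Coalgebra.lTensor_counit_comul (R := k) (a : H)
  have h' : Algebra.TensorProduct.map (.id k H) (Bialgebra.counitAlgHom k H)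
      (Coalgebra.comul (R := k) (a : H)) = (a : H) ⊗ₜ[k] (1 : k) := h
  rw [h']
  simp

/-- The Hopf algebra structure of `H` restricts to `A`. -/
instance instBialgebra : Bialgebra k A.toSubalgebra :=
  Bialgebra.ofAlgHom A.comulHom ((Bialgebra.counitAlgHom k H).comp A.toSubalgebra.val)
    A.coassoc_aux A.rTensor_aux A.lTensor_aux

theorem mul_map_antipode_left (x : A.toSubalgebra ⊗[k] A.toSubalgebra) :
    ((LinearMap.mul' k A.toSubalgebra (A.antipodeMap.rTensor _ x) : A.toSubalgebra) : H) =
      LinearMap.mul' k H ((HopfAlgebra.antipode k).rTensor H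
        (Algebra.TensorProduct.map A.toSubalgebra.val A.toSubalgebra.val x)) := by
  induction x with
  | zero => simp
  | tmul a b => simp [coe_antipodeMap]
  | add x y hx hy => simp only [map_add, Subalgebra.coe_add, hx, hy]

theorem mul_map_antipode_right (x : A.toSubalgebra ⊗[k] A.toSubalgebra) :
    ((LinearMap.mul' k A.toSubalgebra (A.antipodeMap.lTensor _ x) : A.toSubalgebra) : H) =
      LinearMap.mul' k H ((HopfAlgebra.antipode k).lTensor H
        (Algebra.TensorProduct.map A.toSubalgebra.val A.toSubalgebra.val x)) := by
  induction x with
  | zero => simp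
  | tmul a b => simp [coe_antipodeMap]
  | add x y hx hy => simp only [map_add, Subalgebra.coe_add, hx, hy]

instance instHopfAlgebra : HopfAlgebra k A.toSubalgebra where
  antipode := A.antipodeMap
  mul_antipode_rTensor_comul := by
    refine LinearMap.ext fun a => Subtype.val_injective ?_
    refine (A.mul_map_antipode_left (A.comulHom a)).trans ?_
    rw [A.map_comulHom, HopfAlgebra.mul_antipode_rTensor_comul_apply]
    rfl
  mul_antipode_lTensor_comul := by
    refine LinearMap.ext fun a => Subtype.val_injective ?_
    refine (A.mul_map_antipode_right (A.comulHom a)).trans ?_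
    rw [A.map_comulHom, HopfAlgebra.mul_antipode_lTensor_comul_apply]
    rfl

end HopfSubalgebra

end HopfSubalgebra

section DysonSchwinger

/-- Hochschild one-cocycles of a commutative Hopf algebra:
`Δ ∘ B = B ⊗ 1 + (id ⊗ B) ∘ Δ`. -/
def IsHochschildOneCocycle {k : Type u} {H : Type v} [Field k] [CommRing H] [HopfAlgebra k H]
    (B : H →ₗ[k] H) : Prop :=
  ∀ h : H, (Coalgebra.comul (B h) : H ⊗[k] H) =
    B h ⊗ₜ[k] (1 : H) + B.lTensor H (Coalgebra.comul h)

theorem IsHochschildOneCocycle.sum {k : Type u} {H : Type v} [Field k] [CommRing H]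
    [HopfAlgebra k H] (s : Finset ℕ) (B : ℕ → H →ₗ[k] H)
    (h : ∀ n ∈ s, IsHochschildOneCocycle (B n)) :
    IsHochschildOneCocycle (∑ n ∈ s, B n) := by
  intro x
  have e : ∀ y : H ⊗[k] H, (∑ n ∈ s, B n).lTensor H y = ∑ n ∈ s, (B n).lTensor H y := by
    intro y
    rw [← LinearMap.coe_lTensorHom, map_sum, LinearMap.sum_apply]
  rw [e, LinearMap.sum_apply, map_sum, TensorProduct.sum_tmul, ← Finset.sum_add_distrib]
  exact Finset.sum_congr rfl fun n hn => h n hn x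

variable {H : Type u} [CommRing H] [HopfAlgebra ℂ H] {D : Type v}

/-- The data of a combinatorial Dyson--Schwinger equation
`X = 1 + ∑_{n ≥ 1} gⁿ ωₙ Bₙ(Xⁿ⁺¹)`, where `diagram : D → H` lists the connected (1PI)
diagrams. The operator `B n` (for `n ≥ 1`) is the insertion into the primitive element
`B n 1`; it is a Hochschild one-cocycle and its values are linear combinations of connected
diagrams. The equation is not degenerate in its first order. Values at `n = 0` are not used. -/
structure DSE (diagram : D → H) where
  B : ℕ → H →ₗ[ℂ] H
  ω : ℕ → ℂ
  cocycle : ∀ n, 1 ≤ n → IsHochschildOneCocycle (B n)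
  mem_span : ∀ n, 1 ≤ n → ∀ h, B n h ∈ Submodule.span ℂ (Set.range diagram)
  first_diagram_ne_zero : B 1 1 ≠ 0
  first_weight_ne_zero : ω 1 ≠ 0

namespace DSE

variable {diagram : D → H}

/-- The coefficients `Xₙ` of the solution `X = ∑ gⁿ Xₙ` of the equation: `X₀ = 1` and
`Xₙ = ∑_{j=1}^{n} ωⱼ Bⱼ(∑_{k₁+⋯+k_{j+1} = n-j} X_{k₁} ⋯ X_{k_{j+1}})`. -/
def X (p : DSE diagram) : ℕ → H
  | 0 => 1
  | n + 1 => ∑ j ∈ (Finset.Icc 1 (n + 1)).attach, p.ω j •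
      p.B j (∑ k ∈ (Finset.piAntidiag (Finset.univ : Finset (Fin (j + 1))) (n + 1 - j)).attach,
        ∏ i, p.X (k.1 i))
  termination_by n => n
  decreasing_by
    have h1 := Finset.mem_Icc.1 j.2
    have h2 : ∑ i, k.1 i = n + 1 - j := (Finset.mem_piAntidiag.1 k.2).1
    have h3 : k.1 i ≤ ∑ i, k.1 i :=
      Finset.single_le_sum (f := k.1) (fun _ _ => Nat.zero_le _) (Finset.mem_univ i)
    omega

theorem X_succ (p : DSE diagram) (n : ℕ) :
    p.X (n + 1) = ∑ j ∈ Finset.Icc 1 (n + 1), p.ω j •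
      p.B j (∑ k ∈ Finset.piAntidiag (Finset.univ : Finset (Fin (j + 1))) (n + 1 - j),
        ∏ i, p.X (k i)) := by
  rw [X.eq_2, ← Finset.sum_attach (Finset.Icc 1 (n + 1))]
  refine Finset.sum_congr rfl fun j _ => ?_
  rw [← Finset.sum_attach (Finset.piAntidiag _ _)]

/-- The insertion operators of the tower over a family `B`: insertion into
`Γₙ⁽ʲ⁺¹⁾ = Γ₁⁽ʲ⁾ + ⋯ + Γₙ⁽ʲ⁾`, where `Γₙ⁽⁰⁾` is the diagram of `B n`. -/
def towerB (B : ℕ → H →ₗ[ℂ] H) : ℕ → ℕ → H →ₗ[ℂ] H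
  | 0, n => B n
  | j + 1, n => ∑ i ∈ Finset.Icc 1 n, towerB B j i

/-- The `j`-th equation `DSE_p⁽ʲ⁾` of the tower over the equation `p`. -/
def tower (p : DSE diagram) (j : ℕ) : DSE diagram where
  B := towerB p.B j
  ω := p.ω
  cocycle := by
    induction j with
    | zero => exact p.cocycle
    | succ j ih =>
      exact fun n _ => IsHochschildOneCocycle.sum _ _ fun i hi => ih i (Finset.mem_Icc.1 hi).1
  mem_span := by
    induction j with
    | zero => exact p.mem_span
    | succ j ih =>
      intro n _ h
      simp only [towerB, LinearMap.sum_apply]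
      exact Submodule.sum_mem _ fun i hi => ih i (Finset.mem_Icc.1 hi).1 h
  first_diagram_ne_zero := by
    induction j with
    | zero => exact p.first_diagram_ne_zero
    | succ j ih => simpa [towerB] using ih
  first_weight_ne_zero := p.first_weight_ne_zero

end DSE

/-- A Dyson--Schwinger equation with a truncation level `N ∈ {1, 2, …, ∞}`: it stands for the
subalgebra `H(X₁, …, X_N)`, which for `N = ∞` is the algebra `H_DSE` of all coefficients. -/
structure Node (diagram : D → H) where
  eqn : DSE diagram
  level : WithTop ℕ+

variable {diagram : D → H}

/-- The set of generators `X₁, …, X_N`. -/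
def Node.generators (a : Node diagram) : Set H :=
  {x | ∃ m : ℕ+, (m : WithTop ℕ+) ≤ a.level ∧ x = a.eqn.X m}

/-- `H(X₁, …, X_N)`, resp. `H_DSE`, as a graded Hopf subalgebra of `H`: a Hopf subalgebra which
as an algebra is generated by the `X_m`, with the action of `𝔾ₘ(ℂ) = ℂˣ` on its group of
complex characters that corresponds to the grading in which `X_m` has degree `m`.
(At most one such structure exists, as characters are determined by their values on the
`X_m`.) -/
structure GradedHopf (a : Node diagram) where
  hopf : HopfSubalgebra ℂ H
  eq_adjoin : hopf.toSubalgebra = Algebra.adjoin ℂ a.generators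
  scale : ℂˣ →* MulAut (WithConv (hopf.toSubalgebra →ₐ[ℂ] ℂ))
  scale_apply : ∀ (z : ℂˣ) (g : WithConv (hopf.toSubalgebra →ₐ[ℂ] ℂ)) (m : ℕ+)
    (x : hopf.toSubalgebra), (m : WithTop ℕ+) ≤ a.level → (x : H) = a.eqn.X m →
      (scale z g).ofConv x = (z : ℂ) ^ (m : ℕ) * g.ofConv x

namespace GradedHopf

variable {a b : Node diagram}

/-- The underlying algebra. -/
abbrev Alg (A : GradedHopf a) : Type u := A.hopf.toSubalgebra

/-- The complex Lie group `G = Hom_alg(A, ℂ)` of characters with the convolution product. -/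
abbrev Grp (A : GradedHopf a) : Type u := WithConv (A.Alg →ₐ[ℂ] ℂ)

/-- The group `G* = G ⋊ 𝔾ₘ`. -/
abbrev GrpStar (A : GradedHopf a) : Type u := A.Grp ⋊[A.scale] ℂˣ

/-- The regular functions on the pro-algebraic group `G*`: linear combinations of the functions
`(g, z) ↦ g(h) zⁿ` with `h ∈ A` and `n ∈ ℤ`. -/
def regularFunctions (A : GradedHopf a) : Submodule ℂ (A.GrpStar → ℂ) :=
  Submodule.span ℂ {f | ∃ (h : A.Alg) (n : ℤ),
    f = fun x => x.left.ofConv h * ((x.right ^ n : ℂˣ) : ℂ)}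

/-- A finite dimensional representation of `G*` is rational if its matrix coefficients are
regular functions. -/
def isRational (A : GradedHopf a) : ObjectProperty (FDRep ℂ A.GrpStar) :=
  fun V => ∀ (v : V) (ξ : Module.Dual ℂ V), (fun x => ξ (V.ρ x v)) ∈ A.regularFunctions

theorem one_mem_regularFunctions (A : GradedHopf a) : (fun _ => 1) ∈ A.regularFunctions :=
  Submodule.subset_span ⟨1, 0, by simp⟩

theorem mul_mem_regularFunctions (A : GradedHopf a) {f g : A.GrpStar → ℂ}
    (hf : f ∈ A.regularFunctions) (hg : g ∈ A.regularFunctions) :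
    f * g ∈ A.regularFunctions := by
  induction hf using Submodule.span_induction with
  | zero => simp
  | add x y _ _ hx hy => rw [add_mul]; exact add_mem hx hy
  | smul c x _ hx => rw [smul_mul_assoc]; exact Submodule.smul_mem _ _ hx
  | mem x hx =>
    induction hg using Submodule.span_induction with
    | zero => simp
    | add y z _ _ hy hz => rw [mul_add]; exact add_mem hy hz
    | smul c y _ hy => rw [mul_smul_comm]; exact Submodule.smul_mem _ _ hy
    | mem y hy =>
      obtain ⟨h, n, rfl⟩ := hx
      obtain ⟨h', n', rfl⟩ := hy
      refine Submodule.subset_span ⟨h * h', n + n', ?_⟩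
      funext x
      simp [zpow_add]
      ring

open scoped MonoidalCategory in
instance (A : GradedHopf a) : A.isRational.IsMonoidal where
  prop_unit := by
    intro v ξ
    have h : (fun x => ξ ((FDRep.ρ (𝟙_ (FDRep ℂ A.GrpStar)) x) v)) = ξ v • (fun _ => 1) := by
      funext x
      simp
      rfl
    rw [h]
    exact Submodule.smul_mem _ _ A.one_mem_regularFunctions
  prop_tensor V W hV hW := by
    intro t ξ
    let ξ' : (V ⊗[ℂ] W : Type) →ₗ[ℂ] ℂ := ξ
    suffices h : ∀ t : (V ⊗[ℂ] W : Type),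
        (fun x => ξ' (TensorProduct.map (V.ρ x) (W.ρ x) t)) ∈ A.regularFunctions from h t
    intro t
    induction t with
    | zero =>
      simp only [map_zero]
      exact A.regularFunctions.zero_mem
    | add t s ht hs =>
      simp only [map_add]
      exact A.regularFunctions.add_mem ht hs
    | tmul v w =>
      let e := Module.finBasis ℂ V
      have key : (fun x => ξ' (TensorProduct.map (V.ρ x) (W.ρ x) (v ⊗ₜ[ℂ] w))) =
          ∑ i, (fun x => e.coord i (V.ρ x v)) *
            (fun x => (ξ' ∘ₗ TensorProduct.mk ℂ V W (e i)) (W.ρ x w)) := by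
        funext x
        rw [TensorProduct.map_tmul]
        conv_lhs => rw [← e.sum_repr (V.ρ x v)]
        rw [TensorProduct.sum_tmul, map_sum, Finset.sum_apply]
        refine Finset.sum_congr rfl fun i _ => ?_
        rw [← TensorProduct.smul_tmul', map_smul]
        rfl
      rw [key]
      exact Submodule.sum_mem _ fun i _ => A.mul_mem_regularFunctions (hV v _) (hW w _)

/-- The category `Rep_{G*}` of finite dimensional (rational) complex representations of `G*`. -/
abbrev Rep (A : GradedHopf a) := A.isRational.FullSubcategory

/-- The forgetful functor from `Rep_{G*}` to finite dimensional vector spaces. -/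
abbrev forget (A : GradedHopf a) : A.Rep ⥤ FGModuleCat.{0} ℂ :=
  A.isRational.ι ⋙ Action.forget _ _

/-- Morphisms of Hopf algebras `i : A → B` induce homomorphisms `G_B → G_A`, `g ↦ g ∘ i`. -/
def dualHom {A : GradedHopf a} {B : GradedHopf b} (i : A.Alg →ₐc[ℂ] B.Alg) :
    B.Grp →* A.Grp :=
  MonoidHom.mk' (fun g => WithConv.toConv (g.ofConv.comp (i : A.Alg →ₐ[ℂ] B.Alg)))
    fun f g => by
      rw [AlgHom.convMul_comp_bialgHom_distrib]

/-- The natural injective morphisms of Hopf algebras `H(X₁, …, X_N) → H(X'₁, …, X'_{N'})`: those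
which send each `X_m` to `X'_m`. -/
structure IsNatural {A : GradedHopf a} {B : GradedHopf b} (i : A.Alg →ₐc[ℂ] B.Alg) : Prop where
  injective : Function.Injective i
  map_X : ∀ (m : ℕ+) (x : A.Alg), (m : WithTop ℕ+) ≤ a.level →
    (x : H) = a.eqn.X m → (i x : H) = b.eqn.X m

/-- `F : Rep_{G_A*} ⥤ Rep_{G_B*}` is an exact fully faithful (tensor) functor which is
induced, via `σ ↦ σ ∘ f`, by the surjective homomorphism
`f = (g, z) ↦ (g ∘ i, z)` from `G_B*` to `G_A*`, and it identifies `Rep_{G_A*}` with a Tannakian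
subcategory of `Rep_{G_B*}`: the essential image is closed under subobjects and quotients. -/
structure IsInduced {A : GradedHopf a} {B : GradedHopf b} (i : A.Alg →ₐc[ℂ] B.Alg)
    (f : B.GrpStar →* A.GrpStar) (F : A.Rep ⥤ B.Rep) : Prop where
  dual_surjective : Function.Surjective (dualHom i)
  left : ∀ x, (f x).left = dualHom i x.left
  right : ∀ x, (f x).right = x.right
  surjective : Function.Surjective f
  pullback : Nonempty (F ⋙ B.isRational.ι ≅ A.isRational.ι ⋙ Action.res _ f)
  tensor : Nonempty F.Braided
  full : F.Full
  faithful : F.Faithful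
  preservesFiniteLimits : PreservesFiniteLimits F
  preservesFiniteColimits : PreservesFiniteColimits F
  closedUnderSubobjects : F.essImage.IsClosedUnderSubobjects
  closedUnderQuotients : F.essImage.IsClosedUnderQuotients

/-- There is an exact fully faithful functor `Rep_{G_A*} → Rep_{G_B*}` derived from the
epimorphism that is dual to a natural injective morphism of Hopf algebras `A → B`. -/
def Arrow (A : GradedHopf a) (B : GradedHopf b) : Prop :=
  ∃ (i : A.Alg →ₐc[ℂ] B.Alg) (f : B.GrpStar →* A.GrpStar) (F : A.Rep ⥤ B.Rep),
    IsNatural i ∧ IsInduced i f F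

/-- As `Arrow`, for a functor which is an equivalence of categories. -/
def Equivalent (A : GradedHopf a) (B : GradedHopf b) : Prop :=
  ∃ (i : A.Alg →ₐc[ℂ] B.Alg) (f : B.GrpStar →* A.GrpStar) (F : A.Rep ⥤ B.Rep),
    IsNatural i ∧ IsInduced i f F ∧ F.IsEquivalence

end GradedHopf

section Lattice

variable (𝒢 : ∀ a : Node diagram, GradedHopf a) {ι : Type} (node : ι → Node diagram)

/-- The order on a family of categories `Rep_{G_x*}`, `x : ι`: `x ≼ y` (that is,
`Rep_{G_y*} ⪰ Rep_{G_x*}`) if there is a finite sequence of derived exact fully faithful functors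
`Rep_{G_x*} → ⋯ → Rep_{G_y*}` through members of the family. -/
abbrev repPreorder : Preorder ι where
  le := Relation.ReflTransGen fun x y => (𝒢 (node x)).Arrow (𝒢 (node y))
  le_refl _ := Relation.ReflTransGen.refl
  le_trans _ _ _ := Relation.ReflTransGen.trans

/-- The partially ordered set of the categories `Rep_{G_x*}`, `x : ι`, where two members are
identified if each of them precedes the other. -/
def RepClasses : Type := @Antisymmetrization ι (repPreorder 𝒢 node).le _

instance : PartialOrder (RepClasses 𝒢 node) :=
  @instPartialOrderAntisymmetrization ι (repPreorder 𝒢 node)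

/-- The family `Rep_{G_x*}`, `x : ι`, is a lattice for the order `≼`; members which precede each
other are equivalent categories. -/
structure IsRepLattice : Prop where
  lattice : ∃ L : Lattice (RepClasses 𝒢 node),
    L.toPartialOrder = (inferInstance : PartialOrder (RepClasses 𝒢 node))
  equivalent : ∀ x y, (repPreorder 𝒢 node).le x y → (repPreorder 𝒢 node).le y x →
    (𝒢 (node x)).Equivalent (𝒢 (node y))

end Lattice

/-- The family attached to one particle `p`: all `H(X₁, …, X_N)` (with `N = ∞` allowed) for all
equations `DSE_p⁽ʲ⁾`, `j ≥ 0`. -/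
def particleNode (p : DSE diagram) (x : ℕ × WithTop ℕ+) : Node diagram :=
  ⟨p.tower x.1, x.2⟩

/-- Indices for the family attached to a pair of particles. -/
inductive PairIndex (j₁ j₂ : ℕ) : Type
  | left (j : Fin (j₁ + 1)) (N : WithTop ℕ+)
  | right (j : Fin (j₂ + 1)) (N : WithTop ℕ+)
  | bridgeLeft
  | bridge
  | bridgeRight

/-- The family attached to a pair of particles `p, q`: the columns `0, …, j₁` of the family of
`p`, the columns `0, …, j₂` of the family of `q`, and the Hopf algebras of three intermediate
equations `DSE_p^ε`, `DSE_c⁽ᵏ⁾`, `DSE_q^ε`. -/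
def pairNode (p q pε c qε : DSE diagram) (k j₁ j₂ : ℕ) : PairIndex j₁ j₂ → Node diagram
  | .left j N => ⟨p.tower j, N⟩
  | .right j N => ⟨q.tower j, N⟩
  | .bridgeLeft => ⟨pε, ⊤⟩
  | .bridge => ⟨c.tower k, ⊤⟩
  | .bridgeRight => ⟨qε, ⊤⟩

end DysonSchwinger

section Tannakian

/-- A `k`-linear symmetric monoidal category with a functor `ω` to finite dimensional vector
spaces is a neutral Tannakian category with fibre functor `ω`: it is abelian and rigid with
`k`-bilinear tensor product and `End(𝟙) = k`, and `ω` is a `k`-linear exact faithful tensor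
functor. -/
structure IsNeutralTannakian (k : Type u) [Field k] {C : Type v} [Category C]
    [P : Preadditive C] [Linear k C] [MonoidalCategory C] [SymmetricCategory C]
    (ω : C ⥤ FGModuleCat.{u} k) : Prop where
  abelian : ∃ 𝒜 : Abelian C, 𝒜.toPreadditive = P
  rigid : Nonempty (RigidCategory C)
  tensor_preadditive : MonoidalPreadditive C
  tensor_linear : MonoidalLinear k C
  end_unit : Function.Bijective fun c : k => c • 𝟙 (MonoidalCategoryStruct.tensorUnit C)
  additive : ω.Additive
  linear : ω.Linear k
  braided : Nonempty ω.Braided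
  faithful : ω.Faithful
  preservesFiniteLimits : PreservesFiniteLimits ω
  preservesFiniteColimits : PreservesFiniteColimits ω

end Tannakian

end

end QFTEntanglement

open QFTEntanglement CategoryTheory

/-! Two facts carry the theorem. The first is that the cocycle identity gives every Dyson--Schwinger
equation the same coproduct, the Faà di Bruno formula Δ(X_n) = ∑_{a+k=n} (X^{k+1})_a ⊗ X_k, from
which the weights and operators have disappeared (`DSE.comul_X`). The second is that X_1, X_2, …
behave as free variables (`DSE.exists_algHom_X_eq`). Since X_1 is a nonzero primitive element,
contracting the left factor of Δ against a suitable functional lowers the order by one, so the X_n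
are linearly independent. For n ≥ 1 they also lie in the linear span of the free generators of H,
where a linear map with prescribed values extends to a morphism of algebras.

Hence H(X_1, …, X_N) depends on N alone, up to the natural isomorphism. The formula is homogeneous,
so X_m ↦ z^m X'_m defines a morphism of Hopf algebras whenever N ≤ N' (`exists_bialgHom`). For a
single equation this gives the action of 𝔾ₘ; for z = 1 it gives the natural injections, and N ≤ N'
is also necessary (`IsNatural.level_le`). Prescribing values on the X'_n lifts characters, so the
dual homomorphisms are surjective.

Rational representations are closed under subobjects, quotients, finite sums, tensor products and
duals, and so inherit the Tannakian structure. Restriction along a surjection of groups is fully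
faithful, with image closed under subobjects and quotients. The order ≼ therefore only compares
levels. It is total after identification, hence a lattice. -/

namespace QFTEntanglement

noncomputable section

open CategoryTheory CategoryTheory.Limits
open scoped TensorProduct
open Finset.HasAntidiagonal (antidiagonal mem_antidiagonal)

universe u v

/-! ### The Faà di Bruno coproduct of the solution. -/

section Coproduct

variable {H : Type u} [CommRing H] [HopfAlgebra ℂ H]

/-- The generating series `∑ₙ gⁿ ∑_{a + k = n} (fᵏ⁺ʲ)ₐ ⊗ hₖ`. -/
def insertionSeries (f : PowerSeries H) (j : ℕ) (h : PowerSeries H) : PowerSeries (H ⊗[ℂ] H) :=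
  PowerSeries.mk fun n => ∑ x ∈ antidiagonal n,
    PowerSeries.coeff x.1 (f ^ (x.2 + j)) ⊗ₜ[ℂ] PowerSeries.coeff x.2 h

theorem sum_antidiagonal_antidiagonal_comm {M : Type*} [AddCommMonoid M] (n : ℕ)
    (F : ℕ → ℕ → ℕ → ℕ → M) :
    ∑ x ∈ antidiagonal n, ∑ y ∈ antidiagonal x.1, ∑ z ∈ antidiagonal x.2,
      F y.1 y.2 z.1 z.2 =
    ∑ x ∈ antidiagonal n, ∑ y ∈ antidiagonal x.1, ∑ z ∈ antidiagonal x.2,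
      F y.1 z.1 y.2 z.2 := by
  simp only [← Finset.sum_product', Finset.sum_sigma']
  -- Exchanging the two middle entries of a composition of n into four parts is an involution, so
  -- one map serves in both directions.
  refine Finset.sum_nbij'
    (fun t => ⟨(t.2.1.1 + t.2.2.1, t.2.1.2 + t.2.2.2), ((t.2.1.1, t.2.2.1), (t.2.1.2, t.2.2.2))⟩)
    (fun t => ⟨(t.2.1.1 + t.2.2.1, t.2.1.2 + t.2.2.2), ((t.2.1.1, t.2.2.1), (t.2.1.2, t.2.2.2))⟩)
    ?_ ?_ ?_ ?_ ?_
  · rintro ⟨⟨a, b⟩, ⟨⟨c, d⟩, ⟨e, f⟩⟩⟩ h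
    simp only [Finset.mem_sigma, mem_antidiagonal, Finset.mem_product, and_self, and_true] at h ⊢
    omega
  · rintro ⟨⟨a, b⟩, ⟨⟨c, d⟩, ⟨e, f⟩⟩⟩ h
    simp only [Finset.mem_sigma, mem_antidiagonal, Finset.mem_product, and_self, and_true] at h ⊢
    omega
  · rintro ⟨⟨a, b⟩, ⟨⟨c, d⟩, ⟨e, f⟩⟩⟩ h
    simp only [Finset.mem_sigma, mem_antidiagonal, Finset.mem_product] at h ⊢
    obtain ⟨_, rfl, rfl⟩ := h
    rfl
  · rintro ⟨⟨a, b⟩, ⟨⟨c, d⟩, ⟨e, f⟩⟩⟩ h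
    simp only [Finset.mem_sigma, mem_antidiagonal, Finset.mem_product] at h ⊢
    obtain ⟨_, rfl, rfl⟩ := h
    rfl
  · rintro ⟨⟨a, b⟩, ⟨⟨c, d⟩, ⟨e, f⟩⟩⟩ h
    rfl

/-- The exponent is additive: f^{k+j} f^{l+j'} depends only on k + l, so it factors out of the sum
over k and l that forms a coefficient of h h'. -/
theorem insertionSeries_mul (f h h' : PowerSeries H) (j j' : ℕ) :
    insertionSeries f j h * insertionSeries f j' h' = insertionSeries f (j + j') (h * h') := by
  ext n
  simp only [insertionSeries, PowerSeries.coeff_mul, PowerSeries.coeff_mk, Finset.sum_mul_sum,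
    Algebra.TensorProduct.tmul_mul_tmul]
  rw [sum_antidiagonal_antidiagonal_comm n fun a k b l =>
    (PowerSeries.coeff a (f ^ (k + j)) * PowerSeries.coeff b (f ^ (l + j'))) ⊗ₜ[ℂ]
      (PowerSeries.coeff k h * PowerSeries.coeff l h')]
  refine Finset.sum_congr rfl fun x _ => ?_
  rw [Finset.sum_comm, TensorProduct.tmul_sum]
  refine Finset.sum_congr rfl fun z hz => ?_
  rw [← TensorProduct.sum_tmul]
  congr 1
  rw [← (mem_antidiagonal.1 hz), show z.1 + z.2 + (j + j') = z.1 + j + (z.2 + j') by ring,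
    pow_add f (z.1 + j), PowerSeries.coeff_mul]

theorem insertionSeries_pow (f h : PowerSeries H) (j n : ℕ) :
    insertionSeries f j h ^ (n + 1) = insertionSeries f (j * (n + 1)) (h ^ (n + 1)) := by
  induction n with
  | zero => simp
  | succ n ih => rw [pow_succ, ih, insertionSeries_mul, pow_succ h (n + 1)]; congr 1

/-- Powers respect truncation. An induction hypothesis on the coefficients of low order thus reaches
the powers of the series. -/
theorem coeff_pow_congr {R : Type*} [CommSemiring R] {f g : PowerSeries R} {n : ℕ}
    (h : ∀ m ≤ n, PowerSeries.coeff m f = PowerSeries.coeff m g) (j : ℕ) :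
    ∀ m ≤ n, PowerSeries.coeff m (f ^ j) = PowerSeries.coeff m (g ^ j) := by
  induction j with
  | zero => simp
  | succ j ih =>
    intro m hm
    rw [pow_succ, pow_succ, PowerSeries.coeff_mul, PowerSeries.coeff_mul]
    refine Finset.sum_congr rfl fun x hx => ?_
    have := mem_antidiagonal.1 hx
    rw [ih _ (by omega), h _ (by omega)]

theorem coeff_pow_eq_sum_piAntidiag {R : Type*} [CommSemiring R] (f : PowerSeries R) (j n : ℕ) :
    PowerSeries.coeff n (f ^ j) =
      ∑ k ∈ Finset.piAntidiag (Finset.univ : Finset (Fin j)) n, ∏ i, PowerSeries.coeff (k i) f := by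
  have h := PowerSeries.coeff_prod (fun _ : Fin j => f) n Finset.univ
  rw [Finset.prod_const, Finset.card_univ, Fintype.card_fin] at h
  rw [h]
  refine Finset.sum_bij (fun l _ => (l : Fin j → ℕ)) ?_ ?_ ?_ ?_
  · intro l hl
    simpa using (Finset.mem_finsuppAntidiag.1 hl).1
  · intro l _ l' _ e
    exact DFunLike.coe_injective e
  · intro k hk
    refine ⟨Finsupp.equivFunOnFinite.symm k, ?_, rfl⟩
    simpa using hk
  · intro l _
    rfl

namespace DSE

variable {D : Type v} {diagram : D → H} (p : DSE diagram)

/-- The solution `X = ∑ gⁿ Xₙ` as a formal power series. -/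
def series : PowerSeries H := PowerSeries.mk p.X

theorem coeff_series (n : ℕ) : PowerSeries.coeff n p.series = p.X n := PowerSeries.coeff_mk _ _

theorem X_zero : p.X 0 = 1 := by rw [X]

theorem constantCoeff_series : PowerSeries.constantCoeff p.series = 1 := by
  rw [← PowerSeries.coeff_zero_eq_constantCoeff_apply, coeff_series, X_zero]

theorem X_succ_eq_coeff (n : ℕ) : p.X (n + 1) = ∑ x ∈ antidiagonal n,
    p.ω (x.1 + 1) • p.B (x.1 + 1) (PowerSeries.coeff x.2 (p.series ^ (x.1 + 2))) := by
  have h : p.X (n + 1) = ∑ j ∈ Finset.Icc 1 (n + 1), p.ω j •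
      p.B j (PowerSeries.coeff (n + 1 - j) (p.series ^ (j + 1))) := by
    rw [X_succ]
    simp only [coeff_pow_eq_sum_piAntidiag, coeff_series]
  rw [h, Finset.Nat.sum_antidiagonal_eq_sum_range_succ_mk, ← Finset.Ico_add_one_right_eq_Icc,
    Finset.sum_Ico_eq_sum_range]
  refine Finset.sum_congr (by simp) fun j _ => ?_
  simp only [add_comm 1 j, Nat.add_sub_add_right]

theorem X_one : p.X 1 = p.ω 1 • p.B 1 1 := by
  simp [X_succ_eq_coeff, X_zero, series]

theorem X_one_ne_zero : p.X 1 ≠ 0 := by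
  rw [X_one]
  exact smul_ne_zero p.first_weight_ne_zero p.first_diagram_ne_zero

theorem X_mem_span (n : ℕ) : p.X (n + 1) ∈ Submodule.span ℂ (Set.range diagram) := by
  rw [X_succ_eq_coeff]
  exact Submodule.sum_mem _ fun x _ => Submodule.smul_mem _ _ (p.mem_span _ (by omega) _)

/-- The coproduct of the solution is the Faà di Bruno coproduct. -/
theorem comul_X (n : ℕ) : (Coalgebra.comul (R := ℂ) (p.X n) : H ⊗[ℂ] H) =
    ∑ x ∈ antidiagonal n,
      PowerSeries.coeff x.1 (p.series ^ (x.2 + 1)) ⊗ₜ[ℂ] p.X x.2 := by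
  induction n using Nat.strong_induction_on with
  | _ n ih =>
  rcases n with _ | n
  · simp [X_zero, Algebra.TensorProduct.one_def, series]
  -- Δ is multiplicative, so the formula for the series passes to its powers; only orders up to n
  -- are involved.
  have key : ∀ m ≤ n, ∀ j, (Coalgebra.comul (R := ℂ) (PowerSeries.coeff m (p.series ^ (j + 1))) :
      H ⊗[ℂ] H) = ∑ x ∈ antidiagonal m, PowerSeries.coeff x.1 (p.series ^ (x.2 + (j + 1)))
        ⊗ₜ[ℂ] PowerSeries.coeff x.2 (p.series ^ (j + 1)) := by
    intro m hm j
    have h1 : (Coalgebra.comul (R := ℂ) (PowerSeries.coeff m (p.series ^ (j + 1))) : H ⊗[ℂ] H) =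
        PowerSeries.coeff m
          ((PowerSeries.map (Bialgebra.comulAlgHom ℂ H : H →+* H ⊗[ℂ] H) p.series) ^ (j + 1)) := by
      rw [← map_pow, PowerSeries.coeff_map]
      rfl
    rw [h1, coeff_pow_congr (g := insertionSeries p.series 1 p.series) (n := n) ?_ _ m hm,
      insertionSeries_pow, insertionSeries, PowerSeries.coeff_mk]
    · simp
    · intro m hm
      rw [PowerSeries.coeff_map, coeff_series, insertionSeries, PowerSeries.coeff_mk]
      simpa only [coeff_series] using! ih m (by omega)
  rw [Finset.Nat.antidiagonal_succ', Finset.sum_cons, Finset.sum_map]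
  simp only [zero_add, pow_one, coeff_series, X_zero, Function.Embedding.prodMap,
    Function.Embedding.coeFn_mk, Prod.map, Function.Embedding.refl_apply]
  nth_rw 1 [X_succ_eq_coeff]
  rw [map_sum]
  -- By the cocycle identity, the parts B(·) ⊗ 1 add up to X_{n+1} ⊗ 1, which is the term k = 0
  -- split off above.
  have h2 : ∀ x ∈ antidiagonal n, (Coalgebra.comul (R := ℂ)
      (p.ω (x.1 + 1) • p.B (x.1 + 1) (PowerSeries.coeff x.2 (p.series ^ (x.1 + 2)))) : H ⊗[ℂ] H) =
      (p.ω (x.1 + 1) • p.B (x.1 + 1) (PowerSeries.coeff x.2 (p.series ^ (x.1 + 2)))) ⊗ₜ[ℂ] 1 +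
      ∑ y ∈ antidiagonal x.2, PowerSeries.coeff y.1 (p.series ^ (y.2 + (x.1 + 2))) ⊗ₜ[ℂ]
        (p.ω (x.1 + 1) • p.B (x.1 + 1) (PowerSeries.coeff y.2 (p.series ^ (x.1 + 2)))) := by
    intro x hx
    rw [map_smul, p.cocycle _ (by omega), key x.2 (by have := mem_antidiagonal.1 hx; omega),
      smul_add, map_sum, Finset.smul_sum, TensorProduct.smul_tmul']
    simp only [LinearMap.lTensor_tmul, TensorProduct.tmul_smul]
  rw [Finset.sum_congr rfl h2, Finset.sum_add_distrib, ← TensorProduct.sum_tmul,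
    ← X_succ_eq_coeff]
  congr 1
  simp only [X_succ_eq_coeff, TensorProduct.tmul_sum]
  simp only [Finset.sum_sigma']
  -- Terms are indexed by the operator index, the order a on the left and the order of the argument
  -- on the right. Regrouped by a, the other two indices run through the recursion for the right
  -- factor.
  refine Finset.sum_nbij' (fun t => ⟨(t.2.1, t.1.1 + t.2.2), (t.1.1, t.2.2)⟩)
    (fun t => ⟨(t.2.1, t.1.1 + t.2.2), (t.1.1, t.2.2)⟩) ?_ ?_ ?_ ?_ ?_
  · rintro ⟨⟨a, b⟩, ⟨c, d⟩⟩ h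
    simp only [Finset.mem_sigma, mem_antidiagonal, and_true] at h ⊢
    omega
  · rintro ⟨⟨a, b⟩, ⟨c, d⟩⟩ h
    simp only [Finset.mem_sigma, mem_antidiagonal, and_true] at h ⊢
    omega
  · rintro ⟨⟨a, b⟩, ⟨c, d⟩⟩ h
    simp only [Finset.mem_sigma, mem_antidiagonal] at h ⊢
    obtain ⟨_, rfl⟩ := h
    rfl
  · rintro ⟨⟨a, b⟩, ⟨c, d⟩⟩ h
    simp only [Finset.mem_sigma, mem_antidiagonal] at h ⊢
    obtain ⟨_, rfl⟩ := h
    rfl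
  · rintro ⟨⟨a, b⟩, ⟨c, d⟩⟩ h
    simp only
    congr 3
    omega

/-! ### Linear independence of the coefficients and morphisms prescribed on them. -/

theorem comul_X_one : (Coalgebra.comul (R := ℂ) (p.X 1) : H ⊗[ℂ] H) =
    p.X 1 ⊗ₜ[ℂ] 1 + 1 ⊗ₜ[ℂ] p.X 1 := by
  rw [comul_X, Finset.Nat.antidiagonal_succ']
  simp [X_zero, series]

/-- A primitive scalar c vanishes, because ε ⊗ id applied to its coproduct yields 2c = c. -/
theorem X_one_notMem_span_one : p.X 1 ∉ Submodule.span ℂ {(1 : H)} := by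
  intro h
  obtain ⟨c, hc⟩ := Submodule.mem_span_singleton.1 h
  have h1 := congrArg (TensorProduct.lid ℂ H) (Coalgebra.rTensor_counit_comul (R := ℂ) (p.X 1))
  rw [comul_X_one, ← hc] at h1
  have h2 : c • (1 : H) = 0 := by simpa using h1
  exact p.X_one_ne_zero (hc ▸ h2)

/-- A linear endomorphism of `H` which lowers the order of the coefficients `Xₙ` by one. -/
theorem exists_lowering : ∃ δ : H →ₗ[ℂ] H, (∀ n, ∃ y ∈ Submodule.span ℂ (p.X '' Set.Iio n),
    δ (p.X (n + 1)) = (n + 1 : ℂ) • p.X n + y) ∧ δ (p.X 0) = 0 := by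
  -- The functional `l` kills 1 but not X_1. In (l ⊗ id)Δ(X_{n+1}) the term a = 0 has left factor 1
  -- and drops out, the term a = 1 has left factor (n+1) X_1, and the terms a ≥ 2 have right factor
  -- X_k with k < n.
  obtain ⟨l, hl, hl'⟩ := Submodule.exists_le_ker_of_notMem p.X_one_notMem_span_one
  have hl1 : l 1 = 0 := hl' (Submodule.mem_span_singleton_self _)
  set δ : H →ₗ[ℂ] H := (l (p.X 1))⁻¹ •
    ((TensorProduct.lid ℂ H).toLinearMap ∘ₗ l.rTensor H ∘ₗ Coalgebra.comul) with hδ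
  have hX : ∀ n, δ (p.X n) = (l (p.X 1))⁻¹ • ∑ x ∈ antidiagonal n,
      l (PowerSeries.coeff x.1 (p.series ^ (x.2 + 1))) • p.X x.2 := by
    intro n
    simp [hδ, comul_X]
  refine ⟨δ, fun n => ?_, by rw [hX]; simp [X_zero, hl1, p.constantCoeff_series]⟩
  have hc0 := p.constantCoeff_series
  have hc1 : ∀ k : ℕ, PowerSeries.coeff 1 (p.series ^ k) = (k : ℂ) • p.X 1 := by
    intro k
    induction k with
    | zero => simp [PowerSeries.coeff_one]
    | succ k ih =>
      rw [pow_succ, PowerSeries.coeff_mul, Finset.Nat.antidiagonal_succ]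
      simp [ih, coeff_series, X_zero, hc0]
      module
  rw [hX, Finset.Nat.antidiagonal_succ, Finset.sum_cons, Finset.sum_map, smul_add]
  rcases n with _ | n
  · refine ⟨0, zero_mem _, ?_⟩
    simp [coeff_series, X_zero, hc0, hl1, hl]
  · rw [Finset.Nat.antidiagonal_succ, Finset.sum_cons, Finset.sum_map]
    refine ⟨(l (p.X 1))⁻¹ • ∑ x ∈ antidiagonal n,
      l (PowerSeries.coeff (x.1 + 2) (p.series ^ (x.2 + 1))) • p.X x.2, ?_, ?_⟩
    · refine Submodule.smul_mem _ _ (Submodule.sum_mem _ fun x hx => Submodule.smul_mem _ _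
        (Submodule.subset_span ⟨x.2, ?_, rfl⟩))
      have := mem_antidiagonal.1 hx
      simp only [Set.mem_Iio]
      omega
    · simp [hc0, hl1, hc1, smul_smul]
      congr 1
      field_simp

/-- Start from the counit and compose repeatedly with the lowering operator. The factors n + 1 met
on the way are nonzero in ℂ. -/
theorem exists_triangular_dual (n : ℕ) :
    ∃ μ : H →ₗ[ℂ] ℂ, (∀ m < n, μ (p.X m) = 0) ∧ μ (p.X n) ≠ 0 := by
  obtain ⟨δ, hδ, hδ0⟩ := p.exists_lowering
  induction n with
  | zero => exact ⟨Coalgebra.counit, by simp, by simp [X_zero]⟩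
  | succ n ih =>
    obtain ⟨μ, hμ, hn⟩ := ih
    have hspan : ∀ m ≤ n, ∀ y ∈ Submodule.span ℂ (p.X '' Set.Iio m), μ y = 0 := by
      intro m hm y hy
      have : Submodule.span ℂ (p.X '' Set.Iio m) ≤ LinearMap.ker μ := by
        rw [Submodule.span_le]
        rintro _ ⟨k, hk, rfl⟩
        exact hμ k (lt_of_lt_of_le hk hm)
      exact this hy
    refine ⟨μ ∘ₗ δ, fun m hm => ?_, ?_⟩
    · rcases m with _ | m
      · simp [hδ0]
      · obtain ⟨y, hy, e⟩ := hδ m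
        rw [LinearMap.comp_apply, e, map_add, map_smul, hμ m (by omega),
          hspan m (by omega) y hy]
        simp
    · obtain ⟨y, hy, e⟩ := hδ n
      rw [LinearMap.comp_apply, e, map_add, map_smul, hspan n le_rfl y hy, add_zero, smul_eq_mul]
      exact mul_ne_zero (by exact_mod_cast Nat.succ_ne_zero n) hn

/-- In a linear relation, the triangular functional of the largest index with nonzero coefficient
sees that term only. -/
theorem linearIndependent_X : LinearIndependent ℂ p.X := by
  choose μ hμ hμ' using p.exists_triangular_dual
  rw [linearIndependent_iff']
  intro s g hg
  by_contra! hne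
  have hs : (s.filter fun i => g i ≠ 0).Nonempty := by
    obtain ⟨i, hi, hi'⟩ := hne
    exact ⟨i, Finset.mem_filter.2 ⟨hi, hi'⟩⟩
  obtain ⟨i, hi, hmax⟩ : ∃ i ∈ s.filter (fun i => g i ≠ 0),
      ∀ j ∈ s.filter (fun i => g i ≠ 0), j ≤ i :=
    ⟨_, Finset.max'_mem _ hs, fun j => Finset.le_max' _ j⟩
  rw [Finset.mem_filter] at hi
  have h := congrArg (μ i) hg
  rw [map_sum, map_zero, Finset.sum_eq_single i] at h
  · rw [map_smul, smul_eq_mul] at h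
    exact mul_ne_zero hi.2 (hμ' i) h
  · intro j hj hji
    rw [map_smul]
    by_cases hgj : g j = 0
    · simp [hgj]
    · rw [hμ i j (lt_of_le_of_ne (hmax j (Finset.mem_filter.2 ⟨hj, hgj⟩)) hji), smul_zero]
  · exact fun h => absurd hi.1 h

/-- A morphism of algebras from `H` may be prescribed on the coefficients `X₁, X₂, …`. -/
theorem exists_algHom_X_eq (hfree : AlgebraicIndependent ℂ diagram)
    (hgen : Algebra.adjoin ℂ (Set.range diagram) = ⊤) {R : Type*} [CommRing R] [Algebra ℂ R]
    (c : ℕ → R) : ∃ ψ : H →ₐ[ℂ] R, ∀ n, 0 < n → ψ (p.X n) = c n := by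
  obtain ⟨g, hg⟩ := LinearMap.exists_extend
    (Finsupp.linearCombination ℂ c ∘ₗ p.linearIndependent_X.linearCombinationEquiv.symm.toLinearMap)
  have hgX : ∀ n, g (p.X n) = c n := by
    intro n
    have h := LinearMap.congr_fun hg ⟨p.X n, Submodule.subset_span ⟨n, rfl⟩⟩
    have e : p.linearIndependent_X.linearCombinationEquiv (Finsupp.single n 1) =
        ⟨p.X n, Submodule.subset_span ⟨n, rfl⟩⟩ := Subtype.ext (by simp)
    rw [LinearMap.comp_apply, LinearMap.comp_apply, ← e] at h
    simpa using h
  have hsurj : ∀ x : H, x ∈ Algebra.adjoin ℂ (Set.range diagram) := fun x => hgen ▸ trivial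
  let ι : H →ₐ[ℂ] Algebra.adjoin ℂ (Set.range diagram) := (AlgHom.id ℂ H).codRestrict _ hsurj
  -- The morphism `ψ` agrees with `g` on the free generators, hence on their linear span, which
  -- contains X_n for n > 0. The order 0 is excluded: there `g` takes the arbitrary value c_0,
  -- whereas ψ(1) = 1.
  let ψ : H →ₐ[ℂ] R := (MvPolynomial.aeval fun d => g (diagram d)).comp
    (hfree.aevalEquiv.symm.toAlgHom.comp ι)
  have hψ : ∀ d, ψ (diagram d) = g (diagram d) := by
    intro d
    have : hfree.aevalEquiv.symm (ι (diagram d)) = MvPolynomial.X d := by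
      rw [AlgEquiv.symm_apply_eq]
      exact Subtype.ext (by rw [AlgebraicIndependent.aevalEquiv_apply_coe, MvPolynomial.aeval_X]; rfl)
    simp [ψ, this]
  have hspan : ∀ y ∈ Submodule.span ℂ (Set.range diagram), ψ y = g y := by
    intro y hy
    have : Set.EqOn ψ.toLinearMap g (Submodule.span ℂ (Set.range diagram)) := by
      refine LinearMap.eqOn_span ?_
      rintro _ ⟨d, rfl⟩
      exact hψ d
    exact this hy
  refine ⟨ψ, fun n hn => ?_⟩
  obtain ⟨n, rfl⟩ := Nat.exists_eq_succ_of_ne_zero hn.ne'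
  rw [hspan _ (p.X_mem_span n), hgX]

end DSE

end Coproduct

end

end QFTEntanglement

namespace QFTEntanglement

noncomputable section

open CategoryTheory CategoryTheory.Limits
open scoped TensorProduct
open Finset.HasAntidiagonal (antidiagonal mem_antidiagonal)

universe u v

/-! ### The Hopf subalgebras H(X_1, …, X_N), their morphisms and their grading. -/

section Hopf

variable {H : Type u} [CommRing H] [HopfAlgebra ℂ H]

/-- Applying ε ⊗ id to the cocycle identity gives B h = ε(B h) 1 + B h. -/
theorem IsHochschildOneCocycle.counit_apply {B : H →ₗ[ℂ] H} (hB : IsHochschildOneCocycle B)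
    (h : H) : Coalgebra.counit (R := ℂ) (B h) = 0 := by
  have h1 := congrArg (TensorProduct.lid ℂ H) (Coalgebra.rTensor_counit_comul (R := ℂ) (B h))
  have h2 : TensorProduct.lid ℂ H ((Coalgebra.counit (R := ℂ) (A := H)).rTensor H
      (B.lTensor H (Coalgebra.comul h))) = B h := by
    rw [← LinearMap.comp_apply, LinearMap.rTensor_comp_lTensor, ← LinearMap.lTensor_comp_rTensor,
      LinearMap.comp_apply, Coalgebra.rTensor_counit_comul]
    simp
  rw [hB h, map_add, map_add, h2] at h1
  have h3 : Coalgebra.counit (R := ℂ) (B h) • (1 : H) = 0 := by simpa using h1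
  simpa using congrArg (Coalgebra.counit (R := ℂ) (A := H)) h3

variable {D : Type v} {diagram : D → H}

namespace DSE

variable (p q : DSE diagram)

theorem counit_X (n : ℕ) : Coalgebra.counit (R := ℂ) (p.X n) = if n = 0 then 1 else 0 := by
  rcases n with _ | n
  · simp [X_zero]
  · rw [X_succ_eq_coeff, map_sum]
    simp only [map_smul, (p.cocycle _ (Nat.succ_pos _)).counit_apply]
    simp

theorem coeff_series_pow_mem (S : Subalgebra ℂ H) {n : ℕ} (h : ∀ m ≤ n, p.X m ∈ S) (j : ℕ) :
    ∀ m ≤ n, PowerSeries.coeff m (p.series ^ j) ∈ S := by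
  intro m hm
  rw [coeff_pow_eq_sum_piAntidiag]
  refine Subalgebra.sum_mem _ fun k hk => Subalgebra.prod_mem _ fun i _ => ?_
  rw [coeff_series]
  refine h _ (le_trans ?_ hm)
  rw [← (Finset.mem_piAntidiag.1 hk).1]
  exact Finset.single_le_sum (f := k) (fun _ _ => Nat.zero_le _) (Finset.mem_univ i)

variable {p q}

/-- The hypothesis says that `ψ` carries the series of `p` to that of `q` in the variable zg, and
this is inherited by powers. -/
theorem map_coeff_series_pow {ψ : H →ₐ[ℂ] H} {z : ℂ} (hψ : ∀ n, ψ (p.X n) = z ^ n • q.X n)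
    (j n : ℕ) : ψ (PowerSeries.coeff n (p.series ^ j)) =
      z ^ n • PowerSeries.coeff n (q.series ^ j) := by
  have h : PowerSeries.map (ψ : H →+* H) p.series =
      PowerSeries.rescale (algebraMap ℂ H z) q.series := by
    ext n
    rw [PowerSeries.coeff_map, PowerSeries.coeff_rescale, coeff_series, coeff_series, ← map_pow,
      ← Algebra.smul_def]
    exact hψ n
  have h' := congrArg (PowerSeries.coeff n) (congrArg (· ^ j) h)
  simp only [← map_pow, PowerSeries.coeff_map, PowerSeries.coeff_rescale] at h'
  rw [Algebra.smul_def]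
  exact h'

/-- Both equations have the same coproduct formula, and its terms are homogeneous: z^a z^k = z^n. -/
theorem comul_map_X {ψ : H →ₐ[ℂ] H} {z : ℂ} (hψ : ∀ n, ψ (p.X n) = z ^ n • q.X n) (n : ℕ) :
    Algebra.TensorProduct.map ψ ψ (Coalgebra.comul (R := ℂ) (p.X n)) =
      Coalgebra.comul (R := ℂ) (ψ (p.X n)) := by
  rw [hψ, map_smul, comul_X, comul_X, map_sum, Finset.smul_sum]
  refine Finset.sum_congr rfl fun x hx => ?_
  rw [Algebra.TensorProduct.map_tmul, map_coeff_series_pow hψ, hψ, TensorProduct.smul_tmul_smul,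
    ← pow_add, mem_antidiagonal.1 hx]

theorem counit_map_X {ψ : H →ₐ[ℂ] H} {z : ℂ} (hψ : ∀ n, ψ (p.X n) = z ^ n • q.X n) (n : ℕ) :
    Coalgebra.counit (R := ℂ) (ψ (p.X n)) = Coalgebra.counit (R := ℂ) (p.X n) := by
  rw [hψ, map_smul, counit_X, counit_X]
  split_ifs with h <;> simp [h]

end DSE

namespace Node

variable (a : Node diagram)

theorem X_mem_adjoin {m : ℕ+} (hm : (m : WithTop ℕ+) ≤ a.level) :
    ∀ n ≤ (m : ℕ), a.eqn.X n ∈ Algebra.adjoin ℂ a.generators := by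
  intro n hn
  rcases n with _ | n
  · rw [DSE.X_zero]
    exact one_mem _
  · refine Algebra.subset_adjoin ⟨n.succPNat, le_trans ?_ hm, rfl⟩
    exact WithTop.coe_le_coe.2 hn

/-- The identity m(S ⊗ id)Δ = ε determines S(X_n) recursively: the term k = 0 is S(X_n), and the
others involve S(X_m) only for m < n. -/
theorem antipode_X_mem_adjoin {m : ℕ+} (hm : (m : WithTop ℕ+) ≤ a.level) :
    ∀ n ≤ (m : ℕ), HopfAlgebra.antipode ℂ (a.eqn.X n) ∈ Algebra.adjoin ℂ a.generators := by
  intro n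
  induction n using Nat.strong_induction_on with
  | _ n ih =>
  intro hn
  have h := HopfAlgebra.mul_antipode_rTensor_comul_apply (R := ℂ) (a.eqn.X n)
  rw [DSE.comul_X] at h
  rcases n with _ | n
  · simp [DSE.X_zero]
  rw [Finset.Nat.antidiagonal_succ', Finset.sum_cons, Finset.sum_map, map_add, map_add] at h
  rw [← eq_sub_iff_add_eq] at h
  have h0 : LinearMap.mul' ℂ H ((HopfAlgebra.antipode ℂ).rTensor H
      (PowerSeries.coeff (n + 1) (a.eqn.series ^ (0 + 1)) ⊗ₜ[ℂ] a.eqn.X 0)) =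
        HopfAlgebra.antipode ℂ (a.eqn.X (n + 1)) := by
    simp [DSE.X_zero, DSE.coeff_series]
  rw [← h0]
  refine (congrArg (· ∈ Algebra.adjoin ℂ a.generators) h).mpr ?_
  refine Subalgebra.sub_mem _ (Subalgebra.algebraMap_mem _ _) ?_
  rw [map_sum, map_sum]
  refine Subalgebra.sum_mem _ fun x hx => ?_
  have hx' := mem_antidiagonal.1 hx
  simp only [LinearMap.rTensor_tmul, LinearMap.mul'_apply]
  refine Subalgebra.mul_mem _ ?_ (a.X_mem_adjoin hm _ ?_)
  · exact a.eqn.coeff_series_pow_mem ((Algebra.adjoin ℂ a.generators).comap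
      (HopfAlgebra.antipodeAlgHom ℂ H)) (n := n) (fun k hk => ih k (by omega) (by omega)) _ _
      (show x.1 ≤ n by omega)
  · show x.2 + 1 ≤ _
    omega

/-- The Hopf subalgebra `H(X₁, …, X_N)`. -/
def hopf : HopfSubalgebra ℂ H where
  toSubalgebra := Algebra.adjoin ℂ a.generators
  comul_mem := by
    set R := (Algebra.TensorProduct.map (Algebra.adjoin ℂ a.generators).val
      (Algebra.adjoin ℂ a.generators).val).range
    suffices h : Algebra.adjoin ℂ a.generators ≤ R.comap (Bialgebra.comulAlgHom ℂ H) from h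
    refine Algebra.adjoin_le ?_
    rintro _ ⟨m, hm, rfl⟩
    change (Coalgebra.comul (R := ℂ) (a.eqn.X m) : H ⊗[ℂ] H) ∈ R
    rw [DSE.comul_X]
    refine Subalgebra.sum_mem _ fun x hx => ?_
    have hx' := mem_antidiagonal.1 hx
    exact ⟨⟨_, a.eqn.coeff_series_pow_mem _ (a.X_mem_adjoin hm) _ _ (by omega)⟩ ⊗ₜ[ℂ]
      ⟨_, a.X_mem_adjoin hm x.2 (by omega)⟩, rfl⟩
  antipode_mem := by
    suffices h : Algebra.adjoin ℂ a.generators ≤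
        (Algebra.adjoin ℂ a.generators).comap (HopfAlgebra.antipodeAlgHom ℂ H) from h
    refine Algebra.adjoin_le ?_
    rintro _ ⟨m, hm, rfl⟩
    exact a.antipode_X_mem_adjoin hm _ le_rfl

theorem hopf_toSubalgebra : a.hopf.toSubalgebra = Algebra.adjoin ℂ a.generators := rfl

end Node

theorem algHom_ext_of_eq_adjoin {a : Node diagram} {S : Subalgebra ℂ H}
    (hS : S = Algebra.adjoin ℂ a.generators) {R : Type*} [Semiring R] [Algebra ℂ R]
    {f g : S →ₐ[ℂ] R} (h : ∀ (m : ℕ+) (x : S), (m : WithTop ℕ+) ≤ a.level →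
      (x : H) = a.eqn.X m → f x = g x) : f = g := by
  subst hS
  refine AlgHom.ext_of_adjoin_eq_top Algebra.adjoin_adjoin_coe_preimage ?_
  rintro x ⟨m, hm, hx⟩
  exact h m x hm hx

theorem HopfSubalgebra.comul_eq (A : HopfSubalgebra ℂ H) (x : A.toSubalgebra) :
    Algebra.TensorProduct.map A.toSubalgebra.val A.toSubalgebra.val (Coalgebra.comul (R := ℂ) x) =
      Coalgebra.comul (R := ℂ) (x : H) :=
  A.map_comulHom x

/-- For each `z` there is a morphism `H(X₁, …, X_N) → H(X'₁, …, X'_{N'})`, `N ≤ N'`, of Hopf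
algebras which sends each `X_m` to `z ^ m X'_m`. -/
theorem exists_bialgHom (hfree : AlgebraicIndependent ℂ diagram)
    (hgen : Algebra.adjoin ℂ (Set.range diagram) = ⊤) {a b : Node diagram}
    {A B : HopfSubalgebra ℂ H} (hA : A.toSubalgebra = Algebra.adjoin ℂ a.generators)
    (hB : B.toSubalgebra = Algebra.adjoin ℂ b.generators) (hab : a.level ≤ b.level) (z : ℂ) :
    ∃ i : A.toSubalgebra →ₐc[ℂ] B.toSubalgebra, ∀ (m : ℕ+) (x : A.toSubalgebra),
      (m : WithTop ℕ+) ≤ a.level → (x : H) = a.eqn.X m →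
        (i x : H) = z ^ (m : ℕ) • b.eqn.X m := by
  -- On all of H this morphism need not respect the coproduct. It does so on the X_n, and as these
  -- generate `A`, its restriction to `A` is a morphism of bialgebras.
  obtain ⟨ψ, hψ'⟩ := a.eqn.exists_algHom_X_eq hfree hgen fun n => z ^ n • b.eqn.X n
  have hψ : ∀ n, ψ (a.eqn.X n) = z ^ n • b.eqn.X n := by
    intro n
    rcases n with _ | n
    · simp [DSE.X_zero]
    · exact hψ' _ n.succ_pos
  have hmem : ∀ x : A.toSubalgebra, ψ x ∈ B.toSubalgebra := by
    suffices h : A.toSubalgebra ≤ B.toSubalgebra.comap ψ from fun x => h x.2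
    rw [hA, hB]
    refine Algebra.adjoin_le ?_
    rintro _ ⟨m, hm, rfl⟩
    change ψ (a.eqn.X m) ∈ Algebra.adjoin ℂ b.generators
    rw [hψ]
    exact Subalgebra.smul_mem _ (b.X_mem_adjoin (hm.trans hab) _ le_rfl) _
  let i : A.toSubalgebra →ₐ[ℂ] B.toSubalgebra :=
    (ψ.comp A.toSubalgebra.val).codRestrict B.toSubalgebra hmem
  have hi : B.toSubalgebra.val.comp i = ψ.comp A.toSubalgebra.val := rfl
  refine ⟨BialgHom.ofAlgHom i ?_ ?_, fun m x _ hx => ?_⟩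
  · refine algHom_ext_of_eq_adjoin hA fun m x _ hx => ?_
    change Coalgebra.counit (R := ℂ) (ψ x) = Coalgebra.counit (R := ℂ) (x : H)
    rw [hx]
    exact DSE.counit_map_X hψ m
  · refine algHom_ext_of_eq_adjoin hA fun m x _ hx => ?_
    -- B ⊗ B embeds into H ⊗ H, so the coproducts may be compared there.
    refine HopfSubalgebra.map_val_injective B.toSubalgebra ?_
    have h1 : (Algebra.TensorProduct.map B.toSubalgebra.val B.toSubalgebra.val).comp
        (Algebra.TensorProduct.map i i) = (Algebra.TensorProduct.map ψ ψ).comp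
          (Algebra.TensorProduct.map A.toSubalgebra.val A.toSubalgebra.val) := by
      rw [← Algebra.TensorProduct.map_comp, ← Algebra.TensorProduct.map_comp, hi]
    refine (DFunLike.congr_fun h1 (Coalgebra.comul (R := ℂ) x)).trans ?_
    refine (congrArg _ (A.comul_eq x)).trans ?_
    refine Eq.trans ?_ (B.comul_eq (i x)).symm
    change _ = Coalgebra.comul (R := ℂ) (ψ x)
    rw [hx]
    exact DSE.comul_map_X hψ m
  · change ψ x = _
    rw [hx, hψ]

/-- Precomposition with a morphism of Hopf algebras is a homomorphism of groups of characters. -/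
def convComp {A B : Type*} [CommRing A] [CommRing B] [HopfAlgebra ℂ A] [HopfAlgebra ℂ B]
    (i : A →ₐc[ℂ] B) : WithConv (B →ₐ[ℂ] ℂ) →* WithConv (A →ₐ[ℂ] ℂ) :=
  MonoidHom.mk' (fun g => WithConv.toConv (g.ofConv.comp (i : A →ₐ[ℂ] B)))
    fun f g => by rw [AlgHom.convMul_comp_bialgHom_distrib]

/-- The graded Hopf algebra `H(X₁, …, X_N)`. -/
def gradedHopf (hfree : AlgebraicIndependent ℂ diagram)
    (hgen : Algebra.adjoin ℂ (Set.range diagram) = ⊤) (a : Node diagram) : GradedHopf a :=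
  have hθ := exists_bialgHom hfree hgen a.hopf_toSubalgebra a.hopf_toSubalgebra le_rfl
  -- The chosen endomorphisms X_m ↦ z^m X_m compose multiplicatively in z, as is seen on generators;
  -- inverse units therefore give inverse automorphisms.
  have key : ∀ z w : ℂ, ∀ g : WithConv (a.hopf.toSubalgebra →ₐ[ℂ] ℂ),
      convComp (hθ z).choose (convComp (hθ w).choose g) = convComp (hθ (z * w)).choose g := by
    intro z w g
    refine WithConv.ofConv_injective (algHom_ext_of_eq_adjoin a.hopf_toSubalgebra
      fun m x hm hx => ?_)
    change g.ofConv ((hθ w).choose ((hθ z).choose x)) = g.ofConv ((hθ (z * w)).choose x)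
    congr 1
    have e : (hθ z).choose x = z ^ (m : ℕ) • x :=
      Subtype.ext (((hθ z).choose_spec m x hm hx).trans (by rw [← hx]; rfl))
    rw [e, map_smul]
    refine Subtype.ext ?_
    rw [Subalgebra.coe_smul, (hθ w).choose_spec m x hm hx, (hθ (z * w)).choose_spec m x hm hx,
      smul_smul, mul_pow]
  have key1 : ∀ g : WithConv (a.hopf.toSubalgebra →ₐ[ℂ] ℂ), convComp (hθ 1).choose g = g := by
    intro g
    refine WithConv.ofConv_injective (algHom_ext_of_eq_adjoin a.hopf_toSubalgebra
      fun m x hm hx => ?_)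
    change g.ofConv ((hθ 1).choose x) = g.ofConv x
    congr 1
    refine Subtype.ext ?_
    rw [(hθ 1).choose_spec m x hm hx, one_pow, one_smul, hx]
  { hopf := a.hopf
    eq_adjoin := rfl
    scale :=
      { toFun := fun z =>
          { toFun := convComp (hθ z).choose
            invFun := convComp (hθ (z⁻¹ : ℂˣ)).choose
            left_inv := fun g => by rw [key, Units.inv_mul, key1]
            right_inv := fun g => by rw [key, Units.mul_inv, key1]
            map_mul' := map_mul _ }
        map_one' := MulEquiv.ext key1
        map_mul' := fun z w => MulEquiv.ext fun g => (key z w g).symm }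
    scale_apply := fun z g m x hm hx => by
      change g.ofConv ((hθ z).choose x) = _
      have e : (hθ z).choose x = (z : ℂ) ^ (m : ℕ) • x :=
        Subtype.ext (((hθ z).choose_spec m x hm hx).trans (by rw [← hx]; rfl))
      rw [e, map_smul, smul_eq_mul] }

end Hopf

end

end QFTEntanglement

namespace QFTEntanglement

noncomputable section

open CategoryTheory CategoryTheory.Limits
open scoped TensorProduct

universe u v

/-! ### Rational representations form a neutral Tannakian category. -/

section Representations

open scoped MonoidalCategory ZeroObject

theorem FGModuleCat.injective_of_mono {V W : FGModuleCat.{0} ℂ} (f : V ⟶ W) [Mono f] :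
    Function.Injective f.hom.hom :=
  (ModuleCat.mono_iff_injective ((forget₂ (FGModuleCat.{0} ℂ) (ModuleCat.{0} ℂ)).map f)).1
    inferInstance

theorem FGModuleCat.surjective_of_epi {V W : FGModuleCat.{0} ℂ} (f : V ⟶ W) [Epi f] :
    Function.Surjective f.hom.hom :=
  (ModuleCat.epi_iff_surjective ((forget₂ (FGModuleCat.{0} ℂ) (ModuleCat.{0} ℂ)).map f)).1
    inferInstance

theorem FGModuleCat.rightAdjointMate_apply {V : FGModuleCat.{0} ℂ} (f : V ⟶ V)
    (φ : Module.Dual ℂ V) (v : V) :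
    (show Module.Dual ℂ V from (fᘁ).hom.hom φ) v = φ (f.hom.hom v) := by
  have h := rightAdjointMate_comp_evaluation f
  exact congrArg (fun g => g.hom.hom (φ ⊗ₜ[ℂ] v)) h

theorem FDRep.hom_comm {G : Type*} [Monoid G] {V W : FDRep ℂ G} (f : V ⟶ W) (x : G) (v : V) :
    W.ρ x (f.hom.hom.hom v) = f.hom.hom.hom (V.ρ x v) :=
  (congrArg (fun g => g.hom.hom v) (f.comm x)).symm

theorem FDRep.rightDual_ρ_apply {G : Type*} [Group G] (V : FDRep ℂ G) (x : G)
    (φ : Module.Dual ℂ V) (v : V) :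
    (show Module.Dual ℂ V from FDRep.ρ Vᘁ x φ) v = φ (V.ρ x⁻¹ v) := by
  have h : FDRep.ρ Vᘁ x = ((Action.ρ V (x⁻¹ : G))ᘁ).hom.hom := by
    rw [← Action.rightDual_ρ]
    rfl
  rw [h]
  exact FGModuleCat.rightAdjointMate_apply (Action.ρ V (x⁻¹ : G)) φ v

variable {H : Type u} [CommRing H] [HopfAlgebra ℂ H] {D : Type v} {diagram : D → H}

namespace GradedHopf

variable {a : Node diagram} (A : GradedHopf a)

theorem regular_of_alg (h : A.Alg) (n : ℤ) :
    (fun x : A.GrpStar => x.left.ofConv h * ((x.right ^ n : ℂˣ) : ℂ)) ∈ A.regularFunctions :=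
  Submodule.subset_span ⟨h, n, rfl⟩

theorem algebra_induction {P : A.Alg → Prop}
    (X : ∀ (m : ℕ+) (x : A.Alg), (m : WithTop ℕ+) ≤ a.level → (x : H) = a.eqn.X m → P x)
    (algebraMap : ∀ c : ℂ, P (algebraMap ℂ A.Alg c)) (add : ∀ x y, P x → P y → P (x + y))
    (mul : ∀ x y, P x → P y → P (x * y)) (x : A.Alg) : P x := by
  obtain ⟨x, hx⟩ := x
  have hx' : x ∈ Algebra.adjoin ℂ a.generators := A.eq_adjoin ▸ hx
  have key : ∀ x ∈ Algebra.adjoin ℂ a.generators,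
      ∃ h : x ∈ A.hopf.toSubalgebra, P ⟨x, h⟩ := by
    intro x hx
    induction hx using Algebra.adjoin_induction with
    | mem x hx =>
      have hx' : x ∈ A.hopf.toSubalgebra := A.eq_adjoin ▸ Algebra.subset_adjoin hx
      obtain ⟨m, hm, rfl⟩ := hx
      exact ⟨hx', X m _ hm rfl⟩
    | algebraMap c => exact ⟨_, algebraMap c⟩
    | add x y _ _ hx hy => exact ⟨_, add _ _ hx.2 hy.2⟩
    | mul x y _ _ hx hy => exact ⟨_, mul _ _ hx.2 hy.2⟩
  exact (key x hx').2

/-- The inverse of (g, z) is (z⁻¹·g⁻¹, z⁻¹), whose value on X_m is z^{-m} g(S X_m). Sums and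
products then cover all of `A`. This is what makes dual representations rational. -/
theorem inv_mem_regularFunctions {f : A.GrpStar → ℂ} (hf : f ∈ A.regularFunctions) :
    (fun x => f x⁻¹) ∈ A.regularFunctions := by
  induction hf using Submodule.span_induction with
  | zero => exact zero_mem _
  | add f g _ _ hf hg => exact add_mem hf hg
  | smul c f _ hf => exact Submodule.smul_mem _ c hf
  | mem f hf =>
    obtain ⟨h, n, rfl⟩ := hf
    have h1 : (fun x : A.GrpStar => x⁻¹.left.ofConv h) ∈ A.regularFunctions := by
      induction h using A.algebra_induction with
      | X m h hm hh =>
        convert A.regular_of_alg (HopfAlgebra.antipode ℂ h) (-m) using 2 with x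
        rw [SemidirectProduct.inv_left, A.scale_apply _ _ m h hm hh, mul_comm]
        congr 1
        simp
      | algebraMap c =>
        convert A.regularFunctions.smul_mem c A.one_mem_regularFunctions using 2 with x
        simp
      | add h h' hh hh' =>
        convert add_mem hh hh' using 2 with x
        simp
      | mul h h' hh hh' =>
        convert A.mul_mem_regularFunctions hh hh' using 2 with x
        simp
    have h2 : (fun x : A.GrpStar => ((x⁻¹.right ^ n : ℂˣ) : ℂ)) ∈ A.regularFunctions := by
      convert A.regular_of_alg 1 (-n) using 2 with x
      simp
    exact A.mul_mem_regularFunctions h1 h2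

variable {A}

/-- By equivariance this is the coefficient of `V` at v against ξ ∘ f. Quotients and biproducts
reduce to it. -/
theorem coefficient_comp_mem {V W : FDRep ℂ A.GrpStar} (hV : A.isRational V) (f : V ⟶ W)
    (v : V) (ξ : Module.Dual ℂ W) :
    (fun x => ξ (W.ρ x (f.hom.hom.hom v))) ∈ A.regularFunctions := by
  simp only [FDRep.hom_comm]
  exact hV v (ξ ∘ₗ f.hom.hom.hom)

instance : A.isRational.IsClosedUnderSubobjects where
  prop_of_mono {V W} f _ hW := by
    intro v ξ
    have : Mono f.hom := inferInstanceAs (Mono ((Action.forget _ _).map f))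
    -- A linear retraction extends functionals from the subobject to the whole space; it need not be
    -- equivariant.
    obtain ⟨r, hr⟩ := f.hom.hom.hom.exists_leftInverse_of_injective
      (LinearMap.ker_eq_bot.2 (FGModuleCat.injective_of_mono f.hom))
    convert hW (f.hom.hom.hom v) (ξ ∘ₗ r) using 2 with x
    rw [FDRep.hom_comm, LinearMap.comp_apply]
    exact congrArg ξ (LinearMap.congr_fun hr _).symm

instance : A.isRational.IsClosedUnderQuotients where
  prop_of_epi {V W} f _ hV := by
    intro w ξ
    have : Epi f.hom := inferInstanceAs (Epi ((Action.forget _ _).map f))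
    obtain ⟨v, rfl⟩ := FGModuleCat.surjective_of_epi f.hom w
    exact coefficient_comp_mem hV f v ξ

instance : A.isRational.ContainsZero where
  exists_zero := ⟨0, isZero_zero _, fun v ξ => by
    have h : v = 0 := by
      have h0 : 𝟙 (0 : FDRep ℂ A.GrpStar) = 0 := (isZero_zero _).eq_of_src _ _
      exact congrArg (fun g => g.hom.hom.hom v) h0
    rw [h]
    simp only [map_zero]
    exact zero_mem _⟩

theorem isRational_biprod {V W : FDRep ℂ A.GrpStar} (hV : A.isRational V)
    (hW : A.isRational W) : A.isRational (V ⊞ W) := by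
  intro t ξ
  have ht : t = (biprod.inl : V ⟶ V ⊞ W).hom.hom.hom ((biprod.fst : V ⊞ W ⟶ V).hom.hom.hom t) +
      (biprod.inr : W ⟶ V ⊞ W).hom.hom.hom ((biprod.snd : V ⊞ W ⟶ W).hom.hom.hom t) :=
    (congrArg (fun g => g.hom.hom.hom t) (biprod.total (X := V) (Y := W))).symm
  rw [ht]
  simp only [map_add]
  exact add_mem (coefficient_comp_mem hV _ _ ξ) (coefficient_comp_mem hW _ _ ξ)

instance : A.isRational.IsClosedUnderBinaryProducts where
  limitsOfShape_le := by
    rintro X ⟨p⟩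
    exact A.isRational.prop_of_iso (IsLimit.conePointsIsoOfNatIso
      (BinaryBiproduct.isLimit (p.diag.obj ⟨.left⟩) (p.diag.obj ⟨.right⟩)) p.isLimit
      (diagramIsoPair p.diag).symm)
      (isRational_biprod (p.prop_diag_obj ⟨.left⟩) (p.prop_diag_obj ⟨.right⟩))

instance : A.isRational.IsClosedUnderFiniteProducts :=
  ObjectProperty.IsClosedUnderFiniteProducts.mk'

instance : PreservesFiniteLimits A.isRational.ι :=
  have := A.isRational.preservesKernels_ι
  Functor.preservesFiniteLimits_of_preservesKernels _

instance : PreservesFiniteColimits A.isRational.ι :=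
  have := A.isRational.preservesCokernels_ι
  Functor.preservesFiniteColimits_of_preservesCokernels _

theorem isRational_rightDual {V : FDRep ℂ A.GrpStar} (hV : A.isRational V) :
    A.isRational Vᘁ := by
  intro φ t
  -- In finite dimension a functional on the dual is evaluation at a vector, so the coefficient is
  -- that of `V` at x⁻¹.
  obtain ⟨v, hv⟩ := (Module.evalEquiv ℂ V).surjective t
  convert A.inv_mem_regularFunctions (hV v φ) using 2 with x
  rw [← hv]
  exact FDRep.rightDual_ρ_apply V x φ v

/-- The category of rational representations is rigid. -/
abbrev rightRigidCategory : RightRigidCategory A.Rep where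
  rightDual V :=
    { rightDual := ⟨V.objᘁ, isRational_rightDual V.property⟩
      exact :=
        haveI : ExactPairing (A.isRational.ι.obj V)
          (A.isRational.ι.obj ⟨V.objᘁ, isRational_rightDual V.property⟩) :=
            inferInstanceAs (ExactPairing V.obj V.objᘁ)
        ExactPairing.ofFullyFaithful A.isRational.ι _ _ }

theorem end_unit_bijective :
    Function.Bijective fun c : ℂ => c • 𝟙 (𝟙_ A.Rep) := by
  have h1 : ∀ c : ℂ, (c • 𝟙 (𝟙_ A.Rep)).hom.hom.hom.hom (1 : ℂ) = c := fun c => mul_one c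
  constructor
  · intro c d h
    exact (h1 c).symm.trans ((congrArg (fun f => f.hom.hom.hom.hom (1 : ℂ)) h).trans (h1 d))
  · intro f
    refine ⟨f.hom.hom.hom.hom (1 : ℂ), ?_⟩
    refine A.forget.map_injective (InducedCategory.hom_ext (ModuleCat.hom_ext ?_))
    refine LinearMap.ext_ring (R := ℂ) (M₃ := ℂ) ?_
    exact h1 _

theorem isNeutralTannakian (A : GradedHopf a) : IsNeutralTannakian ℂ A.forget where
  abelian := ⟨inferInstance, rfl⟩
  rigid :=
    -- The braiding turns right duals into left duals.
    have := rightRigidCategory (A := A)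
    ⟨BraidedCategory.rigidCategoryOfRightRigidCategory⟩
  tensor_preadditive := inferInstance
  tensor_linear := inferInstance
  end_unit := end_unit_bijective
  additive := inferInstance
  linear := inferInstance
  braided := ⟨inferInstance⟩
  faithful := inferInstance
  preservesFiniteLimits := comp_preservesFiniteLimits _ _
  preservesFiniteColimits := comp_preservesFiniteColimits _ _

end GradedHopf

end Representations

end

end QFTEntanglement

namespace QFTEntanglement

noncomputable section

open CategoryTheory CategoryTheory.Limits
open scoped TensorProduct

universe u v

/-! ### Restriction of actions along a homomorphism. -/

section RestrictionOfActions

variable {G G' : Type*} [Monoid G] [Monoid G'] {f : G →* G'}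

theorem res_full (hf : Function.Surjective f) :
    (Action.res (FGModuleCat.{0} ℂ) f).Full where
  map_surjective {V W} φ := ⟨⟨φ.hom, fun y => by
    obtain ⟨x, rfl⟩ := hf y
    exact φ.comm x⟩, rfl⟩

instance : (Action.res (FGModuleCat.{0} ℂ) f).Faithful where
  map_injective h := Action.Hom.ext (congrArg (fun g => g.hom) h :)

/-- A representation descends along a surjection if its operators do. -/
theorem exists_res_iso (hf : Function.Surjective f) (V : FDRep ℂ G)
    (hV : ∀ x y, f x = f y → V.ρ x = V.ρ y) :
    ∃ W : FDRep ℂ G', Nonempty ((Action.res _ f).obj W ≅ V) := by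
  have hV' : ∀ x y, f x = f y → Action.ρ V x = Action.ρ V y := fun x y h =>
    InducedCategory.hom_ext (ModuleCat.hom_ext (hV x y h))
  have hs := Function.surjInv_eq hf
  -- An element acts through any preimage; independence of the choice makes this multiplicative.
  let ρ' : G' →* End V.V :=
    { toFun := fun y => Action.ρ V (Function.surjInv hf y)
      map_one' := (hV' _ 1 (by rw [hs, map_one])).trans (map_one _)
      map_mul' := fun x y => (hV' _ _ (by rw [hs, map_mul, hs, hs])).trans (map_mul _ _ _) }
  refine ⟨⟨V.V, ρ'⟩, ⟨Action.mkIso (Iso.refl _) fun x => ?_⟩⟩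
  have h : ρ' (f x) = Action.ρ V x := hV' _ _ (hs _)
  change ρ' (f x) ≫ 𝟙 _ = 𝟙 _ ≫ Action.ρ V x
  rw [h, Category.id_comp, Category.comp_id]

end RestrictionOfActions

variable {H : Type u} [CommRing H] [HopfAlgebra ℂ H] {D : Type v} {diagram : D → H}

/-! ### Natural injections, their dual homomorphisms and the induced functors. -/

namespace GradedHopf

variable {a b : Node diagram} {A : GradedHopf a} {B : GradedHopf b}

/-- The forgetful functor preserves finite limits and reflects isomorphisms. Exactness of a pullback
functor can thus be checked on vector spaces. -/
instance (A : GradedHopf a) : ReflectsFiniteLimits A.forget where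
  reflects _ _ _ := by
    have : PreservesFiniteLimits A.forget := comp_preservesFiniteLimits _ _
    exact reflectsLimitsOfShape_of_reflectsIsomorphisms

instance (A : GradedHopf a) : ReflectsFiniteColimits A.forget where
  reflects _ _ _ := by
    have : PreservesFiniteColimits A.forget := comp_preservesFiniteColimits _ _
    exact reflectsColimitsOfShape_of_reflectsIsomorphisms

theorem exists_eq_X (A : GradedHopf a) {m : ℕ+} (hm : (m : WithTop ℕ+) ≤ a.level) :
    ∃ x : A.Alg, (x : H) = a.eqn.X m :=
  ⟨⟨_, A.eq_adjoin ▸ Algebra.subset_adjoin ⟨m, hm, rfl⟩⟩, rfl⟩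

namespace IsNatural

variable {i : A.Alg →ₐc[ℂ] B.Alg}

theorem dualHom_surjective (hi : IsNatural i) (hfree : AlgebraicIndependent ℂ diagram)
    (hgen : Algebra.adjoin ℂ (Set.range diagram) = ⊤) : Function.Surjective (dualHom i) := by
  classical
  intro g
  -- A character of `A` is lifted by giving X'_n its value on X_n. The value 0 where X_n does not
  -- lie in `A` is immaterial.
  obtain ⟨ψ, hψ⟩ := b.eqn.exists_algHom_X_eq hfree hgen fun n =>
    if h : ∃ x : A.Alg, (x : H) = a.eqn.X n then g.ofConv h.choose else 0
  refine ⟨WithConv.toConv (ψ.comp B.hopf.toSubalgebra.val), WithConv.ofConv_injective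
    (algHom_ext_of_eq_adjoin A.eq_adjoin fun m x hm hx => ?_)⟩
  change ψ (i x : H) = g.ofConv x
  have h : ∃ x : A.Alg, (x : H) = a.eqn.X m := ⟨x, hx⟩
  rw [hi.map_X m x hm hx, hψ _ m.pos, dif_pos h]
  congr 1
  exact Subtype.ext (h.choose_spec.trans hx.symm)

/-- If N' < m ≤ N, the morphism X'_m ↦ 1, X'_n ↦ 0 for n ≠ m and the morphism that kills all X'_n, n
≥ 1, agree on the target algebra. Yet they differ at X'_m, the image of X_m. -/
theorem level_le (hi : IsNatural i) (hfree : AlgebraicIndependent ℂ diagram)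
    (hgen : Algebra.adjoin ℂ (Set.range diagram) = ⊤) : a.level ≤ b.level := by
  classical
  by_contra! hlt
  obtain ⟨m, hma, hmb⟩ : ∃ m : ℕ+, (m : WithTop ℕ+) ≤ a.level ∧ b.level < m := by
    obtain ⟨n, hn⟩ := WithTop.ne_top_iff_exists.1 hlt.ne_top
    rw [← hn] at hlt ⊢
    refine ⟨n + 1, ?_, WithTop.coe_lt_coe.2 (PNat.lt_add_right n 1)⟩
    induction ha : a.level using WithTop.recTopCoe with
    | top => exact le_top
    | coe k =>
      rw [ha] at hlt
      exact WithTop.coe_le_coe.2 (PNat.add_one_le_iff.2 (WithTop.coe_lt_coe.1 hlt))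
  obtain ⟨x, hx⟩ := A.exists_eq_X hma
  obtain ⟨ψ, hψ⟩ := b.eqn.exists_algHom_X_eq hfree hgen fun n => if n = m then (1 : ℂ) else 0
  obtain ⟨χ, hχ⟩ := b.eqn.exists_algHom_X_eq hfree hgen fun _ => (0 : ℂ)
  have h : ψ.comp B.hopf.toSubalgebra.val = χ.comp B.hopf.toSubalgebra.val := by
    refine algHom_ext_of_eq_adjoin B.eq_adjoin fun k y hk hy => ?_
    change ψ y = χ y
    rw [hy, hψ _ k.pos, hχ _ k.pos, if_neg]
    intro e
    rw [PNat.coe_inj] at e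
    subst e
    exact absurd hk hmb.not_ge
  have h' : ψ (i x : H) = χ (i x : H) := DFunLike.congr_fun h (i x)
  rw [hi.map_X m x hma hx, hψ _ m.pos, hχ _ m.pos, if_pos rfl] at h'
  exact one_ne_zero h'

end IsNatural

theorem exists_isNatural (hfree : AlgebraicIndependent ℂ diagram)
    (hgen : Algebra.adjoin ℂ (Set.range diagram) = ⊤) (A : GradedHopf a) (B : GradedHopf b)
    (hab : a.level ≤ b.level) : ∃ i : A.Alg →ₐc[ℂ] B.Alg, IsNatural i := by
  obtain ⟨i, hi⟩ := exists_bialgHom hfree hgen A.eq_adjoin B.eq_adjoin hab 1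
  simp only [one_pow, one_smul] at hi
  refine ⟨i, ?_, hi⟩
  -- The morphism X'_n ↦ X_n on H provides a left inverse, whence injectivity.
  obtain ⟨ψ, hψ⟩ := b.eqn.exists_algHom_X_eq hfree hgen a.eqn.X
  have h : (ψ.comp B.hopf.toSubalgebra.val).comp (i : A.Alg →ₐ[ℂ] B.Alg) =
      A.hopf.toSubalgebra.val := by
    refine algHom_ext_of_eq_adjoin A.eq_adjoin fun m x hm hx => ?_
    change ψ (i x : H) = x
    rw [hi m x hm hx, hψ _ m.pos, hx]
  intro x y hxy
  refine Subtype.ext ((DFunLike.congr_fun h x).symm.trans (Eq.trans ?_ (DFunLike.congr_fun h y)))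
  exact congrArg (fun z : B.Alg => ψ (z : H)) hxy

/-- The homomorphism `(g, z) ↦ (g ∘ i, z)` of groups `G_B* → G_A*`. -/
def starHom {i : A.Alg →ₐc[ℂ] B.Alg} (hi : IsNatural i) (hab : a.level ≤ b.level) :
    B.GrpStar →* A.GrpStar :=
  SemidirectProduct.map (dualHom i) (MonoidHom.id _) fun z => MonoidHom.ext fun g =>
    WithConv.ofConv_injective (algHom_ext_of_eq_adjoin A.eq_adjoin fun m x hm hx => by
      change (B.scale z g).ofConv (i x) = (A.scale z (dualHom i g)).ofConv x
      rw [B.scale_apply z g m (i x) (hm.trans hab) (hi.map_X m x hm hx),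
        A.scale_apply z _ m x hm hx]
      rfl)

section Pullback

variable {i : A.Alg →ₐc[ℂ] B.Alg} {f : B.GrpStar →* A.GrpStar}

theorem comp_mem_regularFunctions (hl : ∀ x, (f x).left = dualHom i x.left)
    (hr : ∀ x, (f x).right = x.right) {φ : A.GrpStar → ℂ} (hφ : φ ∈ A.regularFunctions) :
    (fun x => φ (f x)) ∈ B.regularFunctions := by
  induction hφ using Submodule.span_induction with
  | zero => exact zero_mem _
  | add _ _ _ _ hf hg => exact add_mem hf hg
  | smul c _ _ hf => exact Submodule.smul_mem _ c hf
  | mem _ hf =>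
    obtain ⟨h, n, rfl⟩ := hf
    convert B.regular_of_alg (i h) n using 2 with x
    change (f x).left.ofConv h * (((f x).right ^ n : ℂˣ) : ℂ) = _
    rw [hl, hr]
    rfl

/-- The functor `σ ↦ σ ∘ f` between the categories of rational representations. -/
abbrev pullback (hl : ∀ x, (f x).left = dualHom i x.left) (hr : ∀ x, (f x).right = x.right) :
    A.Rep ⥤ B.Rep :=
  B.isRational.lift (A.isRational.ι ⋙ Action.res _ f) fun V v ξ =>
    comp_mem_regularFunctions hl hr (V.property v ξ)

variable (hl : ∀ x, (f x).left = dualHom i x.left) (hr : ∀ x, (f x).right = x.right)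

open scoped MonoidalCategory in
/-- Pulling back representations is compatible with tensor products. -/
instance : (pullback hl hr).Monoidal :=
  -- σ and σ ∘ f share their underlying space, so the structure maps are identities and the faithful
  -- forgetful functor tests coherence.
  Functor.CoreMonoidal.toMonoidal
    { εIso := Iso.refl _
      μIso := fun _ _ => Iso.refl _
      μIso_hom_natural_left := fun f X' => B.forget.map_injective
        ((Category.comp_id _).trans (Category.id_comp _).symm)
      μIso_hom_natural_right := fun X' f => B.forget.map_injective
        ((Category.comp_id _).trans (Category.id_comp _).symm)
      associativity := fun X Y Z => B.forget.map_injective (by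
        change 𝟙 (X.obj.V ⊗ Y.obj.V) ▷ Z.obj.V ≫ 𝟙 ((X.obj.V ⊗ Y.obj.V) ⊗ Z.obj.V) ≫
          (α_ X.obj Y.obj Z.obj).hom.hom =
          (α_ ((pullback hl hr).obj X).obj ((pullback hl hr).obj Y).obj
            ((pullback hl hr).obj Z).obj).hom.hom ≫
            X.obj.V ◁ 𝟙 (Y.obj.V ⊗ Z.obj.V) ≫ 𝟙 (X.obj.V ⊗ Y.obj.V ⊗ Z.obj.V)
        rw [Action.associator_hom_hom, Action.associator_hom_hom]
        change 𝟙 (X.obj.V ⊗ Y.obj.V) ▷ Z.obj.V ≫ 𝟙 ((X.obj.V ⊗ Y.obj.V) ⊗ Z.obj.V) ≫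
          (α_ X.obj.V Y.obj.V Z.obj.V).hom = (α_ X.obj.V Y.obj.V Z.obj.V).hom ≫
            X.obj.V ◁ 𝟙 (Y.obj.V ⊗ Z.obj.V) ≫ 𝟙 (X.obj.V ⊗ Y.obj.V ⊗ Z.obj.V)
        rw [MonoidalCategory.id_whiskerRight, MonoidalCategory.whiskerLeft_id,
          Category.id_comp, Category.id_comp, Category.comp_id, Category.comp_id])
      left_unitality := fun X => B.forget.map_injective (by
        change (λ_ ((pullback hl hr).obj X).obj).hom.hom =
          𝟙 (𝟙_ (FGModuleCat ℂ)) ▷ X.obj.V ≫ 𝟙 (𝟙_ _ ⊗ X.obj.V) ≫ (λ_ X.obj).hom.hom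
        rw [Action.leftUnitor_hom_hom, Action.leftUnitor_hom_hom,
          MonoidalCategory.id_whiskerRight]
        exact ((Category.id_comp _).trans (Category.id_comp _)).symm)
      right_unitality := fun X => B.forget.map_injective (by
        change (ρ_ ((pullback hl hr).obj X).obj).hom.hom =
          X.obj.V ◁ 𝟙 (𝟙_ (FGModuleCat ℂ)) ≫ 𝟙 (X.obj.V ⊗ 𝟙_ _) ≫ (ρ_ X.obj).hom.hom
        rw [Action.rightUnitor_hom_hom, Action.rightUnitor_hom_hom,
          MonoidalCategory.whiskerLeft_id]
        exact ((Category.id_comp _).trans (Category.id_comp _)).symm) }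

open scoped MonoidalCategory in
instance : (pullback hl hr).Braided where
  braided X Y := B.forget.map_injective (by
    change 𝟙 (X.obj.V ⊗ Y.obj.V) ≫ (β_ X.obj.V Y.obj.V).hom =
      (β_ X.obj.V Y.obj.V).hom ≫ 𝟙 (Y.obj.V ⊗ X.obj.V)
    simp)

instance : PreservesFiniteLimits (pullback hl hr) := by
  have : PreservesFiniteLimits (pullback hl hr ⋙ B.forget) :=
    inferInstanceAs (PreservesFiniteLimits (A.isRational.ι ⋙ Action.forget _ _))
  exact preservesFiniteLimits_of_reflects_of_preserves _ B.forget

instance : PreservesFiniteColimits (pullback hl hr) := by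
  have : PreservesFiniteColimits (pullback hl hr ⋙ B.forget) :=
    inferInstanceAs (PreservesFiniteColimits (A.isRational.ι ⋙ Action.forget _ _))
  exact preservesFiniteColimits_of_reflects_of_preserves _ B.forget

theorem essImage_of_res_iso {W : FDRep ℂ A.GrpStar} (hW : A.isRational W) {X : B.Rep}
    (e : (Action.res _ f).obj W ≅ X.obj) : (pullback hl hr).essImage X :=
  ⟨⟨W, hW⟩, ⟨B.isRational.isoMk e⟩⟩

/-- Elements with the same image under `f` act equally on the ambient pullback, hence on the
subobject, which therefore descends. Its embedding descends because restriction along a surjection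
is full, and rationality is then inherited from the ambient object. -/
theorem essImage_isClosedUnderSubobjects (hf : Function.Surjective f) :
    (pullback hl hr).essImage.IsClosedUnderSubobjects where
  prop_of_mono {X Y} g _ hY := by
    obtain ⟨V, ⟨e⟩⟩ := hY
    let k : X.obj ⟶ (Action.res _ f).obj V.obj := (g ≫ e.inv).hom
    have hk : Mono k := inferInstanceAs (Mono (B.isRational.ι.map (g ≫ e.inv)))
    have hk' : Mono k.hom := inferInstanceAs (Mono ((Action.forget _ _).map k))
    have hX : ∀ x y, f x = f y → FDRep.ρ X.obj x = FDRep.ρ X.obj y := by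
      intro x y hxy
      refine LinearMap.ext fun v => FGModuleCat.injective_of_mono k.hom ?_
      refine (FDRep.hom_comm k x v).symm.trans (Eq.trans ?_ (FDRep.hom_comm k y v))
      change FDRep.ρ V.obj (f x) _ = FDRep.ρ V.obj (f y) _
      rw [hxy]
    obtain ⟨W, ⟨e'⟩⟩ := exists_res_iso hf X.obj hX
    have := res_full hf
    let l : W ⟶ V.obj := (Action.res _ f).preimage (e'.hom ≫ k)
    have hl' : (Action.res _ f).map l = e'.hom ≫ k := Functor.map_preimage _ _
    have : Mono ((Action.res (FGModuleCat.{0} ℂ) f).map l) := by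
      rw [hl']
      infer_instance
    have : Mono l := (Action.res _ f).mono_of_mono_map this
    exact essImage_of_res_iso hl hr (A.isRational.prop_of_mono l V.property) e'

theorem essImage_isClosedUnderQuotients (hf : Function.Surjective f) :
    (pullback hl hr).essImage.IsClosedUnderQuotients where
  prop_of_epi {Y X} g _ hY := by
    obtain ⟨V, ⟨e⟩⟩ := hY
    let k : (Action.res _ f).obj V.obj ⟶ X.obj := (e.hom ≫ g).hom
    have hk : Epi k := inferInstanceAs (Epi (B.isRational.ι.map (e.hom ≫ g)))
    have hk' : Epi k.hom := inferInstanceAs (Epi ((Action.forget _ _).map k))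
    have hX : ∀ x y, f x = f y → FDRep.ρ X.obj x = FDRep.ρ X.obj y := by
      intro x y hxy
      refine LinearMap.ext fun v => ?_
      obtain ⟨w, rfl⟩ := FGModuleCat.surjective_of_epi k.hom v
      refine (FDRep.hom_comm k x w).trans (Eq.trans ?_ (FDRep.hom_comm k y w).symm)
      change k.hom.hom.hom (FDRep.ρ V.obj (f x) w) = k.hom.hom.hom (FDRep.ρ V.obj (f y) w)
      rw [hxy]
    obtain ⟨W, ⟨e'⟩⟩ := exists_res_iso hf X.obj hX
    have := res_full hf
    let l : V.obj ⟶ W := (Action.res _ f).preimage (k ≫ e'.inv)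
    have hl' : (Action.res _ f).map l = k ≫ e'.inv := Functor.map_preimage _ _
    have : Epi ((Action.res (FGModuleCat.{0} ℂ) f).map l) := by
      rw [hl']
      infer_instance
    have : Epi l := (Action.res _ f).epi_of_epi_map this
    exact essImage_of_res_iso hl hr (A.isRational.prop_of_epi l V.property) e'

theorem isInduced_pullback (hi : Function.Surjective (dualHom i)) :
    IsInduced i f (pullback hl hr) :=
  have hf : Function.Surjective f := fun y => by
    obtain ⟨g, hg⟩ := hi y.left
    exact ⟨⟨g, y.right⟩, SemidirectProduct.ext ((hl _).trans hg) (hr _)⟩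
  have := res_full hf
  { dual_surjective := hi
    left := hl
    right := hr
    surjective := hf
    pullback := ⟨Iso.refl _⟩
    tensor := ⟨inferInstance⟩
    full := Functor.Full.of_comp_faithful_iso (B.isRational.liftCompιIso _ _)
    faithful := Functor.Faithful.of_comp_iso (B.isRational.liftCompιIso _ _)
    preservesFiniteLimits := inferInstance
    preservesFiniteColimits := inferInstance
    closedUnderSubobjects := essImage_isClosedUnderSubobjects hl hr hf
    closedUnderQuotients := essImage_isClosedUnderQuotients hl hr hf }

end Pullback

end GradedHopf

end

end QFTEntanglement

namespace QFTEntanglement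

open CategoryTheory CategoryTheory.Limits

universe u v

variable {H : Type u} [CommRing H] [HopfAlgebra ℂ H] {D : Type v} {diagram : D → H}

/-! ### Arrows and equivalences are governed by the level. -/

namespace GradedHopf

variable {a b : Node diagram}

theorem exists_isInduced (hfree : AlgebraicIndependent ℂ diagram)
    (hgen : Algebra.adjoin ℂ (Set.range diagram) = ⊤) {A : GradedHopf a} {B : GradedHopf b}
    {i : A.Alg →ₐc[ℂ] B.Alg} (hi : IsNatural i) :
    ∃ (f : B.GrpStar →* A.GrpStar) (F : A.Rep ⥤ B.Rep), IsInduced i f F :=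
  ⟨starHom hi (hi.level_le hfree hgen), _,
    isInduced_pullback (fun _ => rfl) (fun _ => rfl) (hi.dualHom_surjective hfree hgen)⟩

theorem arrow_iff (hfree : AlgebraicIndependent ℂ diagram)
    (hgen : Algebra.adjoin ℂ (Set.range diagram) = ⊤) (A : GradedHopf a) (B : GradedHopf b) :
    A.Arrow B ↔ a.level ≤ b.level := by
  constructor
  · rintro ⟨i, _, _, hi, _⟩
    exact hi.level_le hfree hgen
  · intro hab
    obtain ⟨i, hi⟩ := exists_isNatural hfree hgen A B hab
    obtain ⟨f, F, hF⟩ := exists_isInduced hfree hgen hi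
    exact ⟨i, f, F, hi, hF⟩

theorem IsNatural.comp_eq_id {A : GradedHopf a} {B : GradedHopf b} {i : A.Alg →ₐc[ℂ] B.Alg}
    {j : B.Alg →ₐc[ℂ] A.Alg} (hi : IsNatural i) (hj : IsNatural j) (hab : a.level ≤ b.level)
    (x : A.Alg) : j (i x) = x := by
  have h : (j : B.Alg →ₐ[ℂ] A.Alg).comp (i : A.Alg →ₐ[ℂ] B.Alg) = AlgHom.id ℂ A.Alg := by
    refine algHom_ext_of_eq_adjoin A.eq_adjoin fun m x hm hx => Subtype.ext ?_
    exact (hj.map_X m (i x) (hm.trans hab) (hi.map_X m x hm hx)).trans hx.symm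
  exact DFunLike.congr_fun h x

/-- The natural maps in the two directions are mutually inverse, so pulling an object back along the
inverse homomorphism yields a preimage. -/
theorem equivalent_of_level_eq (hfree : AlgebraicIndependent ℂ diagram)
    (hgen : Algebra.adjoin ℂ (Set.range diagram) = ⊤) (A : GradedHopf a) (B : GradedHopf b)
    (hab : a.level = b.level) : A.Equivalent B := by
  obtain ⟨i, hi⟩ := exists_isNatural hfree hgen A B hab.le
  obtain ⟨j, hj⟩ := exists_isNatural hfree hgen B A hab.ge
  have hF := isInduced_pullback (f := starHom hi hab.le) (fun _ => rfl) (fun _ => rfl)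
    (hi.dualHom_surjective hfree hgen)
  refine ⟨i, _, _, hi, hF, ?_⟩
  have hcomp : (starHom hj hab.ge).comp (starHom hi hab.le) = MonoidHom.id _ := by
    refine MonoidHom.ext fun x => SemidirectProduct.ext ?_ rfl
    exact WithConv.ofConv_injective (AlgHom.ext fun y =>
      congrArg x.left.ofConv (hj.comp_eq_id hi hab.ge y))
  have := hF.full
  have := hF.faithful
  refine { essSurj := ⟨fun X => ?_⟩ }
  let W := (pullback (f := starHom hj hab.ge) (fun _ => rfl) (fun _ => rfl)).obj X
  exact essImage_of_res_iso _ _ W.property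
    ((Action.resComp _ _ _ ≪≫ Action.resCongr _ hcomp ≪≫ Action.resId _).app X.obj)

end GradedHopf

/-! ### The order ≼ is total, hence a lattice. -/

section TotalOrder

/-- A totally ordered set is a lattice. -/
theorem exists_lattice_of_total {α : Type*} [P : PartialOrder α]
    (h : ∀ x y : α, x ≤ y ∨ y ≤ x) : ∃ L : Lattice α, L.toPartialOrder = P := by
  classical
  exact ⟨{ P with
    sup := fun x y => if x ≤ y then y else x
    inf := fun x y => if x ≤ y then x else y
    le_sup_left := fun x y => by split_ifs with hxy <;> [exact hxy; exact le_rfl]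
    le_sup_right := fun x y => by
      split_ifs with hxy
      · exact le_rfl
      · exact (h x y).resolve_left hxy
    sup_le := fun x y z hx hy => by split_ifs <;> assumption
    inf_le_left := fun x y => by
      split_ifs with hxy
      · exact le_rfl
      · exact (h x y).resolve_left hxy
    inf_le_right := fun x y => by split_ifs with hxy <;> [exact hxy; exact le_rfl]
    le_inf := fun x y z hx hy => by split_ifs <;> assumption }, rfl⟩

variable {𝒢 : ∀ a : Node diagram, GradedHopf a} {ι : Type} {node : ι → Node diagram}

/-- Levels do not decrease along a chain of arrows, and a single arrow suffices whenever the levels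
compare. -/
theorem repPreorder_le_iff (hfree : AlgebraicIndependent ℂ diagram)
    (hgen : Algebra.adjoin ℂ (Set.range diagram) = ⊤) (x y : ι) :
    (repPreorder 𝒢 node).le x y ↔ (node x).level ≤ (node y).level := by
  constructor
  · intro h
    have h' : Relation.ReflTransGen (fun x y => (𝒢 (node x)).Arrow (𝒢 (node y))) x y := h
    clear h
    induction h' with
    | refl => exact le_rfl
    | tail _ h ih => exact ih.trans ((GradedHopf.arrow_iff hfree hgen _ _).1 h)
  · intro h
    exact Relation.ReflTransGen.single ((GradedHopf.arrow_iff hfree hgen _ _).2 h)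

theorem isRepLattice (hfree : AlgebraicIndependent ℂ diagram)
    (hgen : Algebra.adjoin ℂ (Set.range diagram) = ⊤) : IsRepLattice 𝒢 node where
  lattice := by
    refine exists_lattice_of_total fun x y => ?_
    induction x using Quotient.inductionOn with | _ x
    induction y using Quotient.inductionOn with | _ y
    have h : (repPreorder 𝒢 node).le x y ∨ (repPreorder 𝒢 node).le y x := by
      rw [repPreorder_le_iff hfree hgen, repPreorder_le_iff hfree hgen]
      exact le_total _ _
    exact h
  equivalent x y hxy hyx := GradedHopf.equivalent_of_level_eq hfree hgen _ _
    (le_antisymm ((repPreorder_le_iff hfree hgen x y).1 hxy)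
      ((repPreorder_le_iff hfree hgen y x).1 hyx))

end TotalOrder

end QFTEntanglement

theorem mainTheorem11 {H : Type*} [CommRing H] [HopfAlgebra ℂ H] {D : Type*}
    (diagram : D → H) (hfree : AlgebraicIndependent ℂ diagram)
    (hgen : Algebra.adjoin ℂ (Set.range diagram) = ⊤) :
    ∃ 𝒢 : ∀ a : Node diagram, GradedHopf a,
      -- all the categories are neutral Tannakian
      (∀ a, IsNeutralTannakian ℂ (𝒢 a).forget) ∧
      -- natural injections of Hopf algebras induce epimorphisms of groups and functors
      (∀ (a b : Node diagram) (i : (𝒢 a).Alg →ₐc[ℂ] (𝒢 b).Alg), GradedHopf.IsNatural i →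
        ∃ (f : (𝒢 b).GrpStar →* (𝒢 a).GrpStar) (F : (𝒢 a).Rep ⥤ (𝒢 b).Rep),
          GradedHopf.IsInduced i f F) ∧
      -- one particle
      (∀ p : DSE diagram,
        (∀ x y : ℕ × WithTop ℕ+, x ≤ y →
          (𝒢 (particleNode p x)).Arrow (𝒢 (particleNode p y))) ∧
        IsRepLattice 𝒢 (particleNode p) ∧
        (∀ x, (repPreorder 𝒢 (particleNode p)).le (0, ((1 : ℕ+) : WithTop ℕ+)) x)) ∧
      -- a pair of particles
      (∀ (p q pε c qε : DSE diagram) (k j₁ j₂ : ℕ),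
        (∀ j < j₁, (𝒢 ⟨p.tower j, ⊤⟩).Arrow (𝒢 ⟨p.tower (j + 1), ⊤⟩)) ∧
        (∀ j < j₂, (𝒢 ⟨q.tower j, ⊤⟩).Arrow (𝒢 ⟨q.tower (j + 1), ⊤⟩)) ∧
        ((𝒢 ⟨p.tower j₁, ⊤⟩).Arrow (𝒢 ⟨pε, ⊤⟩) ∧
          (𝒢 ⟨pε, ⊤⟩).Arrow (𝒢 ⟨c.tower k, ⊤⟩) ∧
          (𝒢 ⟨c.tower k, ⊤⟩).Arrow (𝒢 ⟨qε, ⊤⟩) ∧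
          (𝒢 ⟨qε, ⊤⟩).Arrow (𝒢 ⟨q.tower j₂, ⊤⟩)) ∧
        ((𝒢 ⟨q.tower j₂, ⊤⟩).Arrow (𝒢 ⟨qε, ⊤⟩) ∧
          (𝒢 ⟨qε, ⊤⟩).Arrow (𝒢 ⟨c.tower k, ⊤⟩) ∧
          (𝒢 ⟨c.tower k, ⊤⟩).Arrow (𝒢 ⟨pε, ⊤⟩) ∧
          (𝒢 ⟨pε, ⊤⟩).Arrow (𝒢 ⟨p.tower j₁, ⊤⟩)) ∧
        IsRepLattice 𝒢 (pairNode p q pε c qε k j₁ j₂)) := by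
  have harrow : ∀ a b : Node diagram, a.level ≤ b.level →
      (gradedHopf hfree hgen a).Arrow (gradedHopf hfree hgen b) :=
    fun a b => (GradedHopf.arrow_iff hfree hgen _ _).2
  refine ⟨gradedHopf hfree hgen, fun a => GradedHopf.isNeutralTannakian _,
    fun a b i hi => GradedHopf.exists_isInduced hfree hgen hi, fun p => ⟨?_, ?_, ?_⟩,
    fun p q pε c qε k j₁ j₂ => ⟨?_, ?_, ⟨?_, ?_, ?_, ?_⟩, ⟨?_, ?_, ?_, ?_⟩, ?_⟩⟩
  · exact fun x y hxy => harrow _ _ hxy.2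
  · exact isRepLattice hfree hgen
  · intro x
    refine (repPreorder_le_iff hfree hgen _ _).2 ?_
    change ((1 : ℕ+) : WithTop ℕ+) ≤ x.2
    induction x.2 using WithTop.recTopCoe with
    | top => exact le_top
    | coe k => exact WithTop.coe_le_coe.2 one_le
  -- All full Hopf algebras have level `⊤`, so the arrows between them exist in both directions.
  · exact fun j _ => harrow _ _ le_rfl
  · exact fun j _ => harrow _ _ le_rfl
  all_goals first | exact harrow _ _ le_rfl | exact isRepLattice hfree hgen
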